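/- All logarithms are to base $2$. Consider $N$ users and infinitely many items $i\in\mathbb N$. User types $\tau_U(u)$, $u\in[N]$, are i.i.d. uniform on $[q_U]$ with $q_U=N$ (item structure only), item types $\tau_I(i)$, $i\in\mathbb N$, are i.i.d. uniform on $[q_I]$, the entries $\xi_{k,j}$ of the preference matrix $\Xi\in\{-1,+1\}^{q_U\times q_I}$ are i.i.d. uniform on $\{-1,+1\}$, and the three families are independent. User $u$ rates item $i$ by $L_{u,i}=\xi_{\tau_U(u),\tau_I(i)}$. At each time $t=1,2,\dots$ a (randomized) algorithm recommends to every user $u$ an item $a_{u,t}$, which is a function of the recommendations and ratings of all users at times $1,\dots,t-1$ and of internal randomness independent of the model; no item is recommended twice to the same user. Its regret is $\mathrm{regret}(T)=\mathbb E\sum_{t=1}^T\frac1N\sum_{u=1}^N\mathbf 1[L_{u,a_{u,t}}=-1]$. Let $N>32$, $T\ge1$, $r=\lfloor 0.8\log q_I-4\log\log N\rfloor$ and $\eta=1/\log N$. (a) If $1\le r\le N/2$, then every algorithm satisfies $$\mathrm{regret}(T)\ \ge\ \frac{1-3\eta}{2}\,\max\Big\{1,\ \tfrac12 Z(T),\ \tfrac{r}{N}T\Big\}-\frac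 TN,$$ where $$Z(T)=\begin{cases}\frac T2,& T<\frac{2\sqrt{q_I}}{3N},\\[2pt] \frac{T}{5\log q_I}\big[\log(8q_I\log q_I)-\log(NT)\big],& \frac{2\sqrt{q_I}}{3N}\le T<\frac{4q_I\log q_I}{N},\\[2pt] \frac{T}{8\log q_I},& \frac{4q_I\log q_I}{N}\le T<\frac{16q_I(\log q_I)^2}{N},\\[2pt] \frac12\sqrt{\frac{Tq_I}{N}},& \frac{16q_I(\log q_I)^2}{N}\le T.\end{cases}$$ (b) There are numerical constants $C,c_1,c_2,c_3>0$ such that, whenever $q_I>25(\log N)^5$ and $r\le N/2$, every algorithm satisfies $$\mathrm{regret}(T)\ >\ C\begin{cases}T,& T\le c_1\frac{\sqrt{q_I}\log q_I}{N},\\[2pt] \frac{T}{\log q_I},& c_1\frac{\sqrt{q_I}\log q_I}{N}\le T<c_2\frac{q_I(\log q_I)^2}{N},\\[2pt] \sqrt{\frac{Tq_I}{N}},& c_2\frac{q_I(\log q_I)^2}{N}\le T<c_3\frac{Nq_I}{(\log q_I)^2},\\[2pt] \frac{\log q_I}{N}T,& c_3\frac{Nq_I}{(\log q_I)^2}\le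 T.\end{cases}$$ -/

import Mathlib

open MeasureTheory

universe u

noncomputable section

/-- The latent randomness of the recommendation model with `N` users, `K` user types and `q` item
types: the user types `τ_U : [N] → [K]`, the item types `τ_I : ℕ → [q]` (items are the natural
numbers), and the preference matrix `Ξ ∈ {like, dislike}^{K × q}`.  Throughout, a rating is a
Boolean: `true` stands for `+1` (like) and `false` for `-1` (dislike). -/
abbrev World (N K q : ℕ) : Type :=
  (Fin N → Fin K) × (ℕ → Fin q) × (Fin K → Fin q → Bool)

/-- The law of the latent randomness: the user types are i.i.d. uniform on `[K]`, the item types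
are i.i.d. uniform on `[q]`, the entries of the preference matrix are i.i.d. uniform on
`{like, dislike}`, and the three families are independent. -/
def worldLaw (N K q : ℕ) [NeZero K] [NeZero q] : Measure (World N K q) :=
  (Measure.pi fun _ : Fin N => (PMF.uniformOfFintype (Fin K)).toMeasure).prod
    ((Measure.infinitePi fun _ : ℕ => (PMF.uniformOfFintype (Fin q)).toMeasure).prod
      (Measure.pi fun _ : Fin K => Measure.pi fun _ : Fin q =>
        (PMF.uniformOfFintype Bool).toMeasure))

/-- The rating `L_{u,i} = ξ_{τ_U(u), τ_I(i)}` of user `u` for item `i`. -/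
def rating {N K q : ℕ} (w : World N K q) (u : Fin N) (i : ℕ) : Bool :=
  w.2.2 (w.1 u) (w.2.1 i)

/-- What is observed in the first time steps, in chronological order: each entry of the list is one
time step, and gives for every user the item recommended at that step and the resulting rating. -/
abbrev History (N : ℕ) : Type := List (Fin N → ℕ × Bool)

/-- A (randomized) online recommendation algorithm for `N` users whose internal randomness is a
seed in the measurable space `S`.  Given the history `h` of all earlier time steps, user `u` is
recommended the item `choose u h ζ` (the current time is `h.length + 1`).  The seed is shared by
all users and time steps, which includes the case of separate seeds `ζ_{u,t}`:
then `S` is a product space and `choose u h` reads only the coordinate `(u, h.length + 1)`. -/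
structure Algorithm (N : ℕ) (S : Type u) [MeasurableSpace S] where
  choose : Fin N → History N → S → ℕ
  measurable_choose : ∀ u h, Measurable (choose u h)

namespace Algorithm

variable {N K q : ℕ} {S : Type u} [MeasurableSpace S]

/-- The history of the first `t` time steps when `A` is run on the world `w` with seed `ζ`. -/
def history (A : Algorithm N S) (w : World N K q) (ζ : S) : ℕ → History N
  | 0 => []
  | t + 1 => A.history w ζ t ++
      [fun u => (A.choose u (A.history w ζ t) ζ, rating w u (A.choose u (A.history w ζ t) ζ))]

/-- The item recommended to user `u` after `t` completed time steps, that is `a_{u,t+1}`. -/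
def action (A : Algorithm N S) (w : World N K q) (ζ : S) (u : Fin N) (t : ℕ) : ℕ :=
  A.choose u (A.history w ζ t) ζ

/-- The joint law of the latent randomness and the seed of the algorithm, which are independent;
`ν` is the law of the seed. -/
def runLaw (N K q : ℕ) [NeZero K] [NeZero q] (ν : Measure S) : Measure (World N K q × S) :=
  (worldLaw N K q).prod ν

/-- Almost surely, no item is recommended twice to the same user. -/
def NeverRepeats (A : Algorithm N S) (K q : ℕ) [NeZero K] [NeZero q] (ν : Measure S) : Prop :=
  ∀ᵐ p ∂(runLaw N K q ν), ∀ (u : Fin N) (s t : ℕ), s < t →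
    A.action p.1 p.2 u s ≠ A.action p.1 p.2 u t

/-- The regret at time `T`: the expected number of disliked recommendations per user during the
first `T` time steps. -/
def regret (A : Algorithm N S) (K q : ℕ) [NeZero K] [NeZero q] (ν : Measure S) (T : ℕ) : ℝ :=
  ∫ p, (∑ t ∈ Finset.range T, (1 / (N : ℝ)) *
    ∑ u : Fin N, if rating p.1 u (A.action p.1 p.2 u t) = false then (1 : ℝ) else 0)
    ∂(runLaw N K q ν)

end Algorithm

/-- `r = ⌊0.8 log q - 4 log log N⌋`, with logarithms to the base 2. -/
def ratingThreshold (N q : ℕ) : ℤ :=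
  ⌊0.8 * Real.logb 2 q - 4 * Real.logb 2 (Real.logb 2 N)⌋

/-- `η = 1 / log N`. -/
def etaParam (N : ℕ) : ℝ := 1 / Real.logb 2 N

/-- The piecewise function `Z(T)`. -/
def zBound (N q : ℕ) (T : ℝ) : ℝ :=
  if T < 2 * √(q : ℝ) / (3 * N) then
    T / 2
  else if T < 4 * q * Real.logb 2 q / N then
    T / (5 * Real.logb 2 q) * (Real.logb 2 (8 * q * Real.logb 2 q) - Real.logb 2 (N * T))
  else if T < 16 * q * (Real.logb 2 q) ^ 2 / N then
    T / (8 * Real.logb 2 q)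
  else
    1 / 2 * √(T * q / N)

end

set_option linter.unusedSectionVars false
set_option linter.unusedDecidableInType false
set_option linter.unusedFintypeInType false

/-! ### The finite sequential recommendation model -/

section FiniteModel

open Finset

/-! Serve the users one after another, so that `T` rounds become `N * T` time steps, fix the seed,
and keep only the finitely many items that this seed can ever recommend. The world is then uniform
on a finite set and the regret is `1 / N` times an average of `badCount`, so probabilities become
counts (`Algorithm.le_regret`).

Two mechanisms force dislikes. Flipping an entry of the preference matrix that is never visited does
not change the run, so on average half of the visited (user type, item type) pairs are disliked
(`sum_card_visited_le`). Next, let an item rated by `d < r` user types go to a new type. If the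
matrix is regular, the ratings seen leave about `q / 2 ^ d` candidates for the item type, and the
new user type dislikes about half of them; such fresh recommendations thus fail with probability
near `1 / 2` (`RegularMatrix.card_disliked`, `sum_freshCount_le`). Chernoff and a union bound make
irregular matrices rare (`card_not_regular_le`).

`Z(T)` is a trade-off between the two (`Fair.le_sum_badCount_of_load`). Every touched item costs a
fresh recommendation. If only `n₀` items are touched, then with high probability each item type is
carried by at most `β` of them (`card_load_le`), so a user type consuming `T` distinct items visits
at least `T / β` item types. About `0.63 N` user types occur, rarely fewer than `0.55 N`
(`le_sum_min_types`), hence about `0.55 N T / β` pairs are visited. The regimes of `Z` come from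
balancing `β * n₀ = 0.55 N T`; for the smallest `T`, item types are almost never touched more than
twice and the pairs alone suffice.

The linear bound holds because each item can be fresh for its first `r` user types, which gives
about `r * T` fresh recommendations (`Fair.min_mul_le_freshCount`). The constant bound comes from
the first round, made without information. For part (b) the last regime needs its own choice of `r`
and `η` (`Fair.log_le`), as the threshold `r` can be much smaller than `log q` when `q` is near
`(log N) ^ 5`. -/

/-- A world with finitely many items: user types, item types and preference matrix. -/
abbrev FinWorld (U K ι J : Type*) : Type _ := (U → K) × (ι → J) × (K → J → Bool)

variable {U K ι J : Type*}

/-- The rating of user `u` for item `i`. -/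
def FinWorld.rate (w : FinWorld U K ι J) (u : U) (i : ι) : Bool := w.2.2 (w.1 u) (w.2.1 i)

/-- The user `υ s` is served at time `s`; the item `a w s` recommended at that time depends on the
world only through the ratings collected before. -/
def Causal (υ : ℕ → U) (a : FinWorld U K ι J → ℕ → ι) (H : ℕ) : Prop :=
  ∀ w w' s, s < H → (∀ s' < s, w'.rate (υ s') (a w s') = w.rate (υ s') (a w s')) →
    a w' s = a w s

lemma Causal.eq_of_le {υ : ℕ → U} {a : FinWorld U K ι J → ℕ → ι} {H : ℕ} (ha : Causal υ a H)
    {w w' : FinWorld U K ι J} {s : ℕ}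
    (h : ∀ s' < s, w'.rate (υ s') (a w s') = w.rate (υ s') (a w s')) {s' : ℕ} (hs' : s' ≤ s)
    (hH : s' < H) : a w' s' = a w s' :=
  ha w w' s' hH fun t ht => h t (by omega)

variable [DecidableEq U] [DecidableEq K] [DecidableEq ι] [DecidableEq J]

/-- The pairs (user type, item type) for which a rating has been observed. -/
def visited (υ : ℕ → U) (a : FinWorld U K ι J → ℕ → ι) (H : ℕ) (w : FinWorld U K ι J) :
    Finset (K × J) :=
  (range H).image fun s => (w.1 (υ s), w.2.1 (a w s))

/-- The items that have been recommended. -/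
def touched (a : FinWorld U K ι J → ℕ → ι) (H : ℕ) (w : FinWorld U K ι J) : Finset ι :=
  (range H).image (a w)

/-- The number of disliked recommendations. -/
def badCount (υ : ℕ → U) (a : FinWorld U K ι J → ℕ → ι) (H : ℕ) (w : FinWorld U K ι J) : ℕ :=
  #{s ∈ range H | w.rate (υ s) (a w s) = false}

/-- The number of recommended items of type `j`. -/
def load (a : FinWorld U K ι J → ℕ → ι) (H : ℕ) (w : FinWorld U K ι J) (j : J) : ℕ :=
  #{i ∈ touched a H w | w.2.1 i = j}

/-- The types of the users to whom the item recommended at time `s` was recommended before. -/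
def testers (υ : ℕ → U) (a : FinWorld U K ι J → ℕ → ι) (w : FinWorld U K ι J) (s : ℕ) :
    Finset K :=
  {s' ∈ range s | a w s' = a w s}.image fun s' => w.1 (υ s')

/-- The recommendation at time `s` is made to a user of a new type, and fewer than `r` user types
have rated the item before. -/
def Fresh (υ : ℕ → U) (a : FinWorld U K ι J → ℕ → ι) (r : ℕ) (w : FinWorld U K ι J) (s : ℕ) :
    Prop :=
  w.1 (υ s) ∉ testers υ a w s ∧ #(testers υ a w s) < r

instance (υ : ℕ → U) (a : FinWorld U K ι J → ℕ → ι) (r : ℕ) (w : FinWorld U K ι J) (s : ℕ) :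
    Decidable (Fresh υ a r w s) := by
  unfold Fresh; infer_instance

/-- The number of fresh recommendations. -/
def freshCount (υ : ℕ → U) (a : FinWorld U K ι J → ℕ → ι) (r H : ℕ) (w : FinWorld U K ι J) : ℕ :=
  #{s ∈ range H | Fresh υ a r w s}

/-! #### Unvisited entries of the preference matrix -/

/-- Change the entry `p` of the preference matrix. -/
def flipEntry (p : K × J) (w : FinWorld U K ι J) : FinWorld U K ι J :=
  (w.1, w.2.1, fun k j => if (k, j) = p then !(w.2.2 k j) else w.2.2 k j)

lemma flipEntry_involutive (p : K × J) :
    Function.Involutive (flipEntry p : FinWorld U K ι J → FinWorld U K ι J) := by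
  rintro ⟨x, y, z⟩
  simp only [flipEntry, Prod.mk.injEq, true_and]
  ext k j
  by_cases h : (k, j) = p <;> simp [h]

/-- As long as `p` is not visited, no observed rating depends on that entry, so by causality the two
runs coincide up to time `H`. -/
lemma mem_visited_of_mem_visited_flipEntry {υ : ℕ → U} {a : FinWorld U K ι J → ℕ → ι} {H : ℕ}
    (ha : Causal υ a H) {p : K × J} {w : FinWorld U K ι J}
    (h : p ∈ visited υ a H (flipEntry p w)) : p ∈ visited υ a H w := by
  by_contra hn
  have hne : ∀ s < H, (w.1 (υ s), w.2.1 (a w s)) ≠ p := by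
    intro s hs e
    exact hn (mem_image.2 ⟨s, mem_range.2 hs, e⟩)
  have hag : ∀ s < H, a (flipEntry p w) s = a w s := by
    intro s hs
    refine ha w _ s hs fun s' hs' => ?_
    have := hne s' (by omega)
    simp [FinWorld.rate, flipEntry, this]
  obtain ⟨s, hs, e⟩ := mem_image.1 h
  rw [mem_range] at hs
  refine hne s hs ?_
  rw [← hag s hs]
  exact e

lemma mem_visited_flipEntry {υ : ℕ → U} {a : FinWorld U K ι J → ℕ → ι} {H : ℕ}
    (ha : Causal υ a H) {p : K × J} {w : FinWorld U K ι J} :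
    p ∈ visited υ a H (flipEntry p w) ↔ p ∈ visited υ a H w := by
  refine ⟨mem_visited_of_mem_visited_flipEntry ha, fun h => ?_⟩
  apply mem_visited_of_mem_visited_flipEntry ha
  rwa [flipEntry_involutive]

variable [Fintype U] [Fintype K] [Fintype ι] [Fintype J]

lemma card_disliked_visited_le (υ : ℕ → U) (a : FinWorld U K ι J → ℕ → ι) (H : ℕ)
    (w : FinWorld U K ι J) :
    #{p ∈ visited υ a H w | w.2.2 p.1 p.2 = false} ≤ badCount υ a H w := by
  have : {p ∈ visited υ a H w | w.2.2 p.1 p.2 = false} ⊆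
      ({s ∈ range H | w.rate (υ s) (a w s) = false}).image
        fun s => (w.1 (υ s), w.2.1 (a w s)) := by
    intro p hp
    rw [mem_filter] at hp
    obtain ⟨s, hs, rfl⟩ := mem_image.1 hp.1
    exact mem_image.2 ⟨s, mem_filter.2 ⟨hs, hp.2⟩, rfl⟩
  exact (card_le_card this).trans card_image_le

/-- In expectation at least half of the visited pairs cause a disliked recommendation. -/
lemma sum_card_visited_le {υ : ℕ → U} {a : FinWorld U K ι J → ℕ → ι} {H : ℕ}
    (ha : Causal υ a H) :
    ∑ w, #(visited υ a H w) ≤ 2 * ∑ w, badCount υ a H w := by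
  have key : ∀ p : K × J,
      ∑ w, (if p ∈ visited υ a H w ∧ w.2.2 p.1 p.2 = true then 1 else 0) =
      ∑ w, (if p ∈ visited υ a H w ∧ w.2.2 p.1 p.2 = false then 1 else 0) := by
    intro p
    refine Fintype.sum_equiv (flipEntry_involutive p).toPerm _ _ fun w => ?_
    simp only [Function.Involutive.coe_toPerm, mem_visited_flipEntry ha]
    simp [flipEntry]
  have h1 : ∀ w : FinWorld U K ι J, #(visited υ a H w) =
      ∑ p, (if p ∈ visited υ a H w ∧ w.2.2 p.1 p.2 = true then 1 else 0) +
      ∑ p, (if p ∈ visited υ a H w ∧ w.2.2 p.1 p.2 = false then 1 else 0) := by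
    intro w
    rw [← sum_add_distrib, card_eq_sum_ones, ← sum_filter_add_sum_filter_not univ
      (fun p => p ∈ visited υ a H w)]
    rw [filter_univ_mem, sum_eq_zero (s := filter (fun p => p ∉ visited υ a H w) univ), add_zero]
    · refine sum_congr rfl fun p hp => ?_
      cases w.2.2 p.1 p.2 <;> simp [hp]
    · intro p hp
      simp [(mem_filter.1 hp).2]
  have h2 : ∀ w : FinWorld U K ι J,
      ∑ p, (if p ∈ visited υ a H w ∧ w.2.2 p.1 p.2 = false then 1 else 0) ≤
        badCount υ a H w := by
    intro w
    refine le_trans (le_of_eq ?_) (card_disliked_visited_le υ a H w)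
    rw [← sum_filter, ← card_eq_sum_ones]
    congr 1
    ext p
    simp
  calc ∑ w, #(visited υ a H w)
      = ∑ p, ∑ w, (if p ∈ visited υ a H w ∧ w.2.2 p.1 p.2 = true then 1 else 0) +
        ∑ p, ∑ w, (if p ∈ visited υ a H w ∧ w.2.2 p.1 p.2 = false then 1 else 0) := by
        rw [sum_congr rfl fun w _ => h1 w, sum_add_distrib, sum_comm]
        congr 1
        rw [sum_comm]
    _ = 2 * ∑ w, ∑ p, (if p ∈ visited υ a H w ∧ w.2.2 p.1 p.2 = false then 1 else 0) := by
        rw [sum_congr rfl fun p _ => key p, ← two_mul, sum_comm]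
    _ ≤ _ := by
        gcongr with w
        exact h2 w

/-! #### Resampling an item type -/

/-- Resampling one coordinate of a uniform vector preserves its law. This allows conditioning on
everything except the type of item `i`. -/
lemma card_mul_sum_eq_sum_update (i : ι) (F : (ι → J) → ℝ) :
    Fintype.card J * ∑ τ, F τ = ∑ τ, ∑ j, F (Function.update τ i j) := by
  have h : ∀ G : (ι → J) → ℝ, ∑ τ, G τ =
      ∑ p : J × ({k // k ≠ i} → J), G ((Equiv.funSplitAt i J).symm p) := fun G =>
    (Equiv.sum_comp (Equiv.funSplitAt i J).symm G).symm
  rw [h F, h fun τ => ∑ j, F (Function.update τ i j), Fintype.sum_prod_type, Fintype.sum_prod_type]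
  have h2 : ∀ (x : J) (y : {k // k ≠ i} → J) (j : J),
      Function.update ((Equiv.funSplitAt i J).symm (x, y)) i j =
        (Equiv.funSplitAt i J).symm (j, y) := by
    intro x y j
    ext k
    by_cases hk : k = i
    · subst hk; simp
    · simp [hk]
  simp only [h2]
  rw [sum_const, card_univ, nsmul_eq_mul]
  congr 1
  rw [sum_comm]

/-- Every at most `r` rows of the preference matrix show every pattern in about the expected
proportion of the columns. -/
def RegularMatrix (r : ℕ) (η : ℝ) (X : K → J → Bool) : Prop :=
  ∀ D : Finset K, #D ≤ r → ∀ E ⊆ D,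
    |(#{j | ∀ k ∈ D, (X k j = true ↔ k ∈ E)} : ℝ) - Fintype.card J / 2 ^ #D| ≤
      η * (Fintype.card J / 2 ^ #D)

/-- Fix all but the type `j` of item `i`. Up to time `s` the run depends on `j` only through the
ratings by the testers, so the good `j` split into classes, each consisting of all columns with a
prescribed pattern on a tester set `D`. The disliked members of a class show a prescribed pattern on
one more row. Regularity compares the two sizes, and the worst ratio is `(1 - η) / (2 * (1 + η))`.
-/
lemma RegularMatrix.card_disliked {υ : ℕ → U} {a : FinWorld U K ι J → ℕ → ι} {H : ℕ}
    (ha : Causal υ a H) {r : ℕ} {η : ℝ} (hη0 : 0 ≤ η) {X : K → J → Bool}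
    (hX : RegularMatrix r η X) (x : U → K) (τ : ι → J) (i : ι) {s : ℕ} (hs : s < H) :
    (1 - η) / (2 * (1 + η)) * #{j | a (x, Function.update τ i j, X) s = i ∧
        Fresh υ a r (x, Function.update τ i j, X) s} ≤
      #{j | (a (x, Function.update τ i j, X) s = i ∧
        Fresh υ a r (x, Function.update τ i j, X) s) ∧ X (x (υ s)) j = false} := by
  set w : J → FinWorld U K ι J := fun j => (x, Function.update τ i j, X) with hw
  set Y : Finset J := {j | a (w j) s = i ∧ Fresh υ a r (w j) s} with hY
  set k₀ := x (υ s)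
  have hagree : ∀ j ∈ Y, ∀ j', (∀ k ∈ testers υ a (w j) s, X k j' = X k j) →
      ∀ s' ≤ s, a (w j') s' = a (w j) s' := by
    intro j hj j' h s' hs'
    rw [hY, mem_filter] at hj
    refine ha.eq_of_le (s := s) (fun t ht => ?_) hs' (by omega)
    by_cases hti : a (w j) t = i
    · have hk : x (υ t) ∈ testers υ a (w j) s := by
        refine mem_image.2 ⟨t, mem_filter.2 ⟨mem_range.2 ht, ?_⟩, rfl⟩
        rw [hti, hj.2.1]
      have h1 := h _ hk
      rw [hti]
      simpa [FinWorld.rate, hw] using h1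
    · simp only [FinWorld.rate]
      simp [hw] at hti ⊢
      rw [Function.update_of_ne hti, Function.update_of_ne hti]
  have htest : ∀ j ∈ Y, ∀ j', (∀ k ∈ testers υ a (w j) s, X k j' = X k j) →
      testers υ a (w j') s = testers υ a (w j) s := by
    intro j hj j' h
    have := hagree j hj j' h
    unfold testers
    rw [this s le_rfl]
    congr 1
    refine filter_congr fun t ht => ?_
    rw [this t (mem_range.1 ht).le]
  have hmem : ∀ j ∈ Y, ∀ j', (∀ k ∈ testers υ a (w j) s, X k j' = X k j) → j' ∈ Y := by
    intro j hj j' h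
    have h1 := hagree j hj j' h s le_rfl
    have h2 := htest j hj j' h
    rw [hY, mem_filter] at hj ⊢
    refine ⟨mem_univ _, by rw [h1, hj.2.1], ?_⟩
    unfold Fresh
    rw [h2]
    exact hj.2.2
  -- The class of `j`: who tested item `i` before time `s`, and which of them liked it.
  let g : J → Finset K × Finset K := fun j =>
    (testers υ a (w j) s, {k ∈ testers υ a (w j) s | X k j = true})
  have hfib : ∀ j ∈ Y, ∀ j', (j' ∈ Y ∧ g j' = g j) ↔
      ∀ k ∈ testers υ a (w j) s, (X k j' = true ↔ k ∈ (g j).2) := by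
    intro j hj j'
    constructor
    · rintro ⟨-, h⟩ k hk
      have h1 : testers υ a (w j') s = testers υ a (w j) s := congrArg Prod.fst h
      rw [← h]
      simp [g, h1, hk]
    · intro h
      have h' : ∀ k ∈ testers υ a (w j) s, X k j' = X k j := by
        intro k hk
        have := h k hk
        simp only [g, mem_filter, hk, true_and] at this
        exact Bool.eq_iff_iff.2 this
      refine ⟨hmem j hj j' h', ?_⟩
      have h1 := htest j hj j' h'
      simp only [g, h1, Prod.mk.injEq, true_and]
      refine filter_congr fun k hk => ?_
      rw [h' k hk]
  have hfilt : #{j | (a (w j) s = i ∧ Fresh υ a r (w j) s) ∧ X k₀ j = false} =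
      #{j ∈ Y | X k₀ j = false} := by
    rw [hY, filter_filter]
  rw [hfilt, card_eq_sum_card_image g Y,
    card_eq_sum_card_fiberwise (s := {j ∈ Y | X k₀ j = false}) (t := Y.image g) (f := g)
      (fun j hj => mem_coe.2 (mem_image_of_mem g (mem_filter.1 hj).1))]
  push_cast
  rw [mul_sum]
  refine sum_le_sum fun v hv => ?_
  obtain ⟨j, hj, rfl⟩ := mem_image.1 hv
  have hFr : Fresh υ a r (w j) s := by
    rw [hY, mem_filter] at hj; exact hj.2.2
  set D := testers υ a (w j) s with hD
  have hsub : (g j).2 ⊆ D := filter_subset _ _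
  have e1 : ({j' ∈ Y | g j' = g j} : Finset J) = ({j' | ∀ k ∈ D, (X k j' = true ↔ k ∈ (g j).2)} : Finset J) := by
    ext j'
    rw [mem_filter, hfib j hj j']
    simp [hD]
  have hk₀ : k₀ ∉ D := hFr.1
  -- Since `k₀` is outside the liking set, adding it to the rows demands exactly a dislike by `k₀`.
  have e2 : ({j' ∈ {j' ∈ Y | X k₀ j' = false} | g j' = g j} : Finset J) =
      ({j' | ∀ k ∈ insert k₀ D, (X k j' = true ↔ k ∈ (g j).2)} : Finset J) := by
    ext j'
    rw [mem_filter, mem_filter, and_right_comm, hfib j hj j']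
    have : k₀ ∉ (g j).2 := fun h => hk₀ (hsub h)
    simp only [← hD, forall_mem_insert, this, iff_false, Bool.not_eq_true, mem_filter, mem_univ,
      true_and]
    exact and_comm
  rw [e1, e2]
  have b1 := hX D hFr.2.le _ hsub
  -- The strict bound in `Fresh` leaves room for this one extra row.
  have b2 := hX (insert k₀ D) (by rw [card_insert_of_notMem hk₀]; exact hFr.2) _
    (hsub.trans (subset_insert _ _))
  rw [card_insert_of_notMem hk₀, pow_succ] at b2
  rw [abs_le] at b1 b2
  set q : ℝ := (Fintype.card J : ℝ)
  set P : ℝ := q / 2 ^ #D with hP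
  have hP' : q / (2 ^ #D * 2) = P / 2 := by rw [hP]; field_simp
  rw [hP'] at b2
  have hpos : 0 < 1 + η := by linarith
  set A : ℝ := (#{j' | ∀ k ∈ D, (X k j' = true ↔ k ∈ (g j).2)} : ℝ)
  set B : ℝ := (#{j' | ∀ k ∈ insert k₀ D, (X k j' = true ↔ k ∈ (g j).2)} : ℝ)
  have hA : A ≤ (1 + η) * P := by linarith [b1.2]
  have hB : (1 - η) * P / 2 ≤ B := by linarith [b2.1]
  have hB0 : 0 ≤ B := Nat.cast_nonneg _
  have hA0 : 0 ≤ A := Nat.cast_nonneg _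
  by_cases h1 : η ≤ 1
  · calc (1 - η) / (2 * (1 + η)) * A ≤ (1 - η) / (2 * (1 + η)) * ((1 + η) * P) := by
          have : 0 ≤ 1 - η := by linarith
          gcongr
      _ = (1 - η) * P / 2 := by field_simp
      _ ≤ B := hB
  · refine le_trans ?_ hB0
    apply mul_nonpos_of_nonpos_of_nonneg _ hA0
    apply div_nonpos_of_nonpos_of_nonneg <;> linarith

end FiniteModel

section FiniteModel

open Finset

variable {U K ι J : Type*} [DecidableEq U] [DecidableEq K] [DecidableEq ι] [DecidableEq J]
  [Fintype U] [Fintype K] [Fintype ι] [Fintype J]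

open Classical in
/-- On regular preference matrices, fresh recommendations are disliked with probability close
to `1 / 2`. -/
lemma sum_freshCount_le {υ : ℕ → U} {a : FinWorld U K ι J → ℕ → ι} {H : ℕ}
    (ha : Causal υ a H) [Nonempty J] {r : ℕ} {η : ℝ} (hη0 : 0 ≤ η) :
    (1 - η) / (2 * (1 + η)) *
      ∑ w : FinWorld U K ι J, (if RegularMatrix r η w.2.2 then (freshCount υ a r H w : ℝ) else 0) ≤
    ∑ w, (badCount υ a H w : ℝ) := by
  set c := (1 - η) / (2 * (1 + η))
  have key : ∀ s < H, ∀ (x : U → K) (X : K → J → Bool), RegularMatrix r η X →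
      c * ∑ τ : ι → J, (if Fresh υ a r (x, τ, X) s then (1 : ℝ) else 0) ≤
      ∑ τ : ι → J, if FinWorld.rate (x, τ, X) (υ s) (a (x, τ, X) s) = false then (1 : ℝ) else 0 := by
    intro s hs x X hX
    have h1 : ∀ i, c * ∑ τ : ι → J, (if a (x, τ, X) s = i ∧ Fresh υ a r (x, τ, X) s
        then (1 : ℝ) else 0) ≤
        ∑ τ : ι → J, if a (x, τ, X) s = i ∧ X (x (υ s)) (τ i) = false then (1 : ℝ) else 0 := by
      intro i
      have hq : (0 : ℝ) < Fintype.card J := by exact_mod_cast Fintype.card_pos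
      refine le_of_mul_le_mul_left ?_ hq
      rw [mul_left_comm, card_mul_sum_eq_sum_update i, card_mul_sum_eq_sum_update i, mul_sum]
      refine sum_le_sum fun τ _ => ?_
      have := hX.card_disliked ha hη0 x τ i hs
      rw [sum_boole, sum_boole]
      refine this.trans ?_
      norm_cast
      refine card_le_card fun j hj => ?_
      simp only [mem_filter, mem_univ, true_and, Function.update_self] at hj ⊢
      exact ⟨hj.1.1, hj.2⟩
    have h2 := sum_le_sum fun i (_ : i ∈ (univ : Finset ι)) => h1 i
    rw [← mul_sum, sum_comm, sum_comm (s := (univ : Finset ι))] at h2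
    refine le_trans (le_of_eq ?_) (h2.trans (le_of_eq ?_))
    · congr 1
      refine sum_congr rfl fun τ _ => ?_
      by_cases hF : Fresh υ a r (x, τ, X) s <;> simp [hF]
    · refine sum_congr rfl fun τ _ => ?_
      rw [sum_eq_single (a (x, τ, X) s)]
      · by_cases hd : X (x (υ s)) (τ (a (x, τ, X) s)) = false <;> simp [FinWorld.rate, hd]
      · intro i _ hi
        simp [hi.symm]
      · simp
  have hb : ∀ w : FinWorld U K ι J, (badCount υ a H w : ℝ) =
      ∑ s ∈ range H, if w.rate (υ s) (a w s) = false then (1 : ℝ) else 0 := by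
    intro w
    rw [badCount, sum_boole]
  have hf : ∀ w : FinWorld U K ι J, (freshCount υ a r H w : ℝ) =
      ∑ s ∈ range H, if Fresh υ a r w s then (1 : ℝ) else 0 := by
    intro w
    rw [freshCount, sum_boole]
  simp only [hb, hf, Fintype.sum_prod_type]
  rw [mul_sum]
  refine sum_le_sum fun x _ => ?_
  rw [sum_comm, sum_comm (s := (univ : Finset (ι → J))), mul_sum]
  refine sum_le_sum fun X _ => ?_
  by_cases hX : RegularMatrix r η X
  · simp only [hX, if_true]
    rw [sum_comm, sum_comm (s := (univ : Finset (ι → J))), mul_sum]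
    exact sum_le_sum fun s hs => key s (mem_range.1 hs) x X hX
  · simp only [hX, if_false, sum_const_zero, mul_zero]
    exact sum_nonneg fun τ _ => sum_nonneg fun s _ => by positivity

/-! #### Counting fresh recommendations -/

/-- Each of the first `r` distinct values of `κ` along the times satisfying `p` is counted when it
first appears. -/
lemma min_le_card_new (κ : ℕ → K) (p : ℕ → Prop) [DecidablePred p] (r H : ℕ) :
    min r #({s ∈ range H | p s}.image κ) ≤
      #{s ∈ range H | p s ∧ κ s ∉ {s' ∈ range s | p s'}.image κ ∧
        #({s' ∈ range s | p s'}.image κ) < r} := by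
  induction H with
  | zero => simp
  | succ H ih =>
    rw [range_add_one, filter_insert, filter_insert]
    by_cases hp : p H
    · simp only [hp, if_true, true_and]
      rw [image_insert]
      by_cases hm : κ H ∈ {s' ∈ range H | p s'}.image κ
      · rw [insert_eq_of_mem hm]
        simpa [hm] using ih
      · rw [card_insert_of_notMem hm]
        by_cases hr : #({s' ∈ range H | p s'}.image κ) < r
        · rw [if_pos ⟨hm, hr⟩, card_insert_of_notMem (by simp)]
          omega
        · rw [if_neg (fun h => hr h.2)]
          omega
    · simpa [hp] using ih

/-- The types of the users to whom the item `i` was recommended. -/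
def raters (υ : ℕ → U) (a : FinWorld U K ι J → ℕ → ι) (H : ℕ) (w : FinWorld U K ι J) (i : ι) :
    Finset K :=
  {s ∈ range H | a w s = i}.image fun s => w.1 (υ s)

lemma sum_min_card_raters_le (υ : ℕ → U) (a : FinWorld U K ι J → ℕ → ι) (r H : ℕ)
    (w : FinWorld U K ι J) :
    ∑ i ∈ touched a H w, min r #(raters υ a H w i) ≤ freshCount υ a r H w := by
  rw [freshCount, card_eq_sum_card_fiberwise (t := touched a H w) (f := a w)]
  · refine sum_le_sum fun i _ => ?_
    refine (min_le_card_new (fun s => w.1 (υ s)) (fun s => a w s = i) r H).trans ?_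
    refine card_le_card fun s hs => ?_
    simp only [mem_filter] at hs ⊢
    obtain ⟨h1, h2, h3⟩ := hs
    refine ⟨⟨h1, ?_⟩, h2⟩
    unfold Fresh testers
    rw [h2]
    exact h3
  · intro s hs
    exact mem_coe.2 (mem_image_of_mem _ (mem_filter.1 hs).1)

lemma card_touched_le_freshCount (υ : ℕ → U) (a : FinWorld U K ι J → ℕ → ι) {r : ℕ} (hr : 1 ≤ r)
    (H : ℕ) (w : FinWorld U K ι J) : #(touched a H w) ≤ freshCount υ a r H w := by
  refine le_trans ?_ (sum_min_card_raters_le υ a r H w)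
  rw [card_eq_sum_ones]
  refine sum_le_sum fun i hi => le_min hr ?_
  obtain ⟨s, hs, rfl⟩ := mem_image.1 hi
  exact card_pos.2 ⟨_, mem_image_of_mem _ (mem_filter.2 ⟨hs, rfl⟩)⟩

/-- Every user is served `T` times before time `H`, and never gets an item twice. -/
structure Fair (υ : ℕ → U) (a : FinWorld U K ι J → ℕ → ι) (H T : ℕ) : Prop where
  card_times : ∀ u, #{s ∈ range H | υ s = u} = T
  injOn : ∀ w u, Set.InjOn (a w) {s | s < H ∧ υ s = u}

/-- The items recommended to users of type `k`. -/
def itemsOf (υ : ℕ → U) (a : FinWorld U K ι J → ℕ → ι) (H : ℕ) (w : FinWorld U K ι J) (k : K) :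
    Finset ι :=
  {s ∈ range H | w.1 (υ s) = k}.image (a w)

lemma Fair.le_card_itemsOf {υ : ℕ → U} {a : FinWorld U K ι J → ℕ → ι} {H T : ℕ}
    (h : Fair υ a H T) (w : FinWorld U K ι J) {k : K} (hk : k ∈ univ.image w.1) :
    T ≤ #(itemsOf υ a H w k) := by
  obtain ⟨u, -, rfl⟩ := mem_image.1 hk
  rw [← h.card_times u, ← card_image_of_injOn (f := a w)]
  · refine card_le_card (image_subset_image fun s hs => ?_)
    rw [mem_filter] at hs ⊢
    exact ⟨hs.1, by rw [hs.2]⟩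
  · intro s hs t ht e
    rw [mem_coe, mem_filter, mem_range] at hs ht
    exact h.injOn w u hs ht e

/-- Double counting of the pairs (user type, item recommended to that type). -/
lemma Fair.card_mul_le_sum_card_raters {υ : ℕ → U} {a : FinWorld U K ι J → ℕ → ι} {H T : ℕ}
    (h : Fair υ a H T) (w : FinWorld U K ι J) :
    #(univ.image w.1) * T ≤ ∑ i ∈ touched a H w, #(raters υ a H w i) := by
  have e1 : ∑ i ∈ touched a H w, #(raters υ a H w i) =
      #((touched a H w).sigma fun i => raters υ a H w i) := (card_sigma _ _).symm
  have e2 : ∑ k ∈ univ.image w.1, #(itemsOf υ a H w k) =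
      #((univ.image w.1).sigma fun k => itemsOf υ a H w k) := (card_sigma _ _).symm
  rw [e1, ← smul_eq_mul, ← sum_const]
  refine (sum_le_sum fun k hk => h.le_card_itemsOf w hk).trans ?_
  rw [e2]
  refine card_le_card_of_injOn (fun p => ⟨p.2, p.1⟩) ?_ ?_
  · rintro ⟨k, i⟩ hp
    rw [mem_coe, mem_sigma] at hp
    obtain ⟨s, hs, e⟩ := mem_image.1 hp.2
    rw [mem_filter] at hs
    refine mem_coe.2 (mem_sigma.2 ⟨mem_image.2 ⟨s, hs.1, e⟩, ?_⟩)
    exact mem_image.2 ⟨s, mem_filter.2 ⟨hs.1, e⟩, hs.2⟩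
  · rintro ⟨k, i⟩ _ ⟨k', i'⟩ _ e
    simp only [Sigma.mk.injEq, heq_eq_eq] at e
    obtain ⟨rfl, rfl⟩ := e
    rfl

/-- An item with `x ≤ d` raters gives at least `min r x ≥ (min r d / d) * x` fresh recommendations,
by concavity, and the values `x` sum to at least `d * T`. -/
lemma Fair.min_mul_le_freshCount {υ : ℕ → U} {a : FinWorld U K ι J → ℕ → ι} {H T : ℕ}
    (h : Fair υ a H T) (r : ℕ) (w : FinWorld U K ι J) :
    min r #(univ.image w.1) * T ≤ freshCount υ a r H w := by
  refine le_trans ?_ (sum_min_card_raters_le υ a r H w)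
  set d := #(univ.image w.1)
  rcases Nat.eq_zero_or_pos d with h0 | h0
  · simp [h0]
  refine Nat.le_of_mul_le_mul_left ?_ h0
  calc d * (min r d * T) = min r d * (d * T) := by ring
    _ ≤ min r d * ∑ i ∈ touched a H w, #(raters υ a H w i) :=
        Nat.mul_le_mul_left _ (h.card_mul_le_sum_card_raters w)
    _ ≤ d * ∑ i ∈ touched a H w, min r #(raters υ a H w i) := by
        rw [mul_sum, mul_sum]
        refine sum_le_sum fun i _ => ?_
        have hle : #(raters υ a H w i) ≤ d := by
          refine card_le_card fun k hk => ?_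
          obtain ⟨s, _, rfl⟩ := mem_image.1 hk
          exact mem_image_of_mem _ (mem_univ _)
        rcases le_total r #(raters υ a H w i) with h1 | h1
        · rw [min_eq_left h1, min_eq_left (h1.trans hle), mul_comm d]
          exact Nat.mul_le_mul_left _ hle
        · rw [min_eq_right h1]
          exact Nat.mul_le_mul_right _ (min_le_right _ _)

/-- If no item type is touched more than `b` times, then many pairs are visited. -/
lemma Fair.card_mul_le_mul_card_visited {υ : ℕ → U} {a : FinWorld U K ι J → ℕ → ι} {H T : ℕ}
    (h : Fair υ a H T) (w : FinWorld U K ι J) {b : ℝ} (hb : ∀ j, (load a H w j : ℝ) ≤ b) :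
    (#(univ.image w.1) * T : ℝ) ≤ b * #(visited υ a H w) := by
  have h1 : ∀ k, (#(itemsOf υ a H w k) : ℝ) ≤ b * #{p ∈ visited υ a H w | p.1 = k} := by
    intro k
    have hmaps : ∀ i ∈ itemsOf υ a H w k,
        (k, w.2.1 i) ∈ ({p ∈ visited υ a H w | p.1 = k} : Finset (K × J)) := by
      intro i hi
      obtain ⟨s, hs, rfl⟩ := mem_image.1 hi
      rw [mem_filter] at hs ⊢
      exact ⟨mem_image.2 ⟨s, hs.1, by rw [hs.2]⟩, rfl⟩
    rw [card_eq_sum_card_fiberwise (f := fun i => (k, w.2.1 i))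
      (t := {p ∈ visited υ a H w | p.1 = k}) hmaps]
    push_cast
    rw [mul_comm, ← nsmul_eq_mul, ← sum_const]
    refine sum_le_sum fun p hp => le_trans ?_ (hb p.2)
    norm_cast
    refine card_le_card fun i hi => ?_
    rw [mem_filter] at hi ⊢
    obtain ⟨h1, h2⟩ := hi
    refine ⟨?_, by rw [← h2]⟩
    obtain ⟨s, hs, rfl⟩ := mem_image.1 h1
    exact mem_image_of_mem _ (mem_filter.1 hs).1
  have h2 : (#(visited υ a H w) : ℝ) =
      ∑ k ∈ univ.image w.1, (#{p ∈ visited υ a H w | p.1 = k} : ℝ) := by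
    rw [card_eq_sum_card_fiberwise (f := Prod.fst) (t := univ.image w.1)]
    · push_cast; rfl
    · intro p hp
      obtain ⟨s, _, rfl⟩ := mem_image.1 hp
      exact mem_coe.2 (mem_image_of_mem _ (mem_univ _))
  rw [h2, mul_sum, ← nsmul_eq_mul, ← sum_const]
  refine sum_le_sum fun k hk => le_trans ?_ (h1 k)
  exact_mod_cast h.le_card_itemsOf w hk

/-! #### The types of the touched items -/

/-- If the set `S τ` is determined by the restriction of `τ` to it, then weighting the coordinates
in `S τ` by a function of mean `1` does not change the total mass. -/
lemma sum_prod_of_stopping {S : (ι → J) → Finset ι}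
    (hS : ∀ τ τ', (∀ i ∈ S τ, τ' i = τ i) → S τ' = S τ) {φ : J → ℝ} (hφ : ∑ j, φ j = Fintype.card J)
    [Nonempty J] :
    ∑ τ, ∏ i ∈ S τ, φ (τ i) = (Fintype.card J : ℝ) ^ Fintype.card ι := by
  -- Take an independent copy `σ` and exchange `τ` and `σ` off `S τ`. As `S` is determined by what
  -- it reveals, it is unchanged, so the exchange is an involution. Evaluating `∑ ∏ φ` before and
  -- after it gives the claim, because the coordinates off `S τ` are then independent of mean `1`.
  let mix : (ι → J) → (ι → J) → ι → J := fun τ σ i => if i ∈ S τ then τ i else σ i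
  let mix' : (ι → J) → (ι → J) → ι → J := fun τ σ i => if i ∈ S τ then σ i else τ i
  have hmix : ∀ τ σ, S (mix τ σ) = S τ := fun τ σ => hS _ _ fun i hi => by simp [mix, hi]
  let e : (ι → J) × (ι → J) → (ι → J) × (ι → J) := fun p => (mix p.1 p.2, mix' p.1 p.2)
  have he : Function.Involutive e := by
    rintro ⟨τ, σ⟩
    simp only [e, Prod.mk.injEq]
    constructor <;> ext i <;> by_cases hi : i ∈ S τ <;>
      simp only [mix, mix', hi, if_true, if_false] <;>
      rw [show (fun i => if i ∈ S τ then τ i else σ i) = mix τ σ from rfl, hmix] <;> simp [hi]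
  have hq : (0 : ℝ) < Fintype.card J := by exact_mod_cast Fintype.card_pos
  have hall : ∑ τ : ι → J, ∏ i, φ (τ i) = (Fintype.card J : ℝ) ^ Fintype.card ι := by
    rw [← Fintype.piFinset_univ, ← prod_univ_sum (fun _ : ι => (univ : Finset J)) fun _ j => φ j]
    simp [hφ]
  have hpart : ∀ A : Finset ι, ∑ σ : ι → J, ∏ i, (if i ∈ A then 1 else φ (σ i)) =
      (Fintype.card J : ℝ) ^ Fintype.card ι := by
    intro A
    rw [← Fintype.piFinset_univ, ← prod_univ_sum (fun _ : ι => (univ : Finset J))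
      fun i j => if i ∈ A then 1 else φ j]
    rw [prod_congr rfl (g := fun _ => (Fintype.card J : ℝ)), prod_const, card_univ]
    intro i _
    by_cases hi : i ∈ A <;> simp [hi, hφ]
  have hpair : ∑ p : (ι → J) × (ι → J), ∏ i, φ (mix p.1 p.2 i) =
      ∑ p : (ι → J) × (ι → J), ∏ i, φ (p.1 i) :=
    Fintype.sum_equiv he.toPerm _ _ fun p => rfl
  have hl : ∑ p : (ι → J) × (ι → J), ∏ i, φ (mix p.1 p.2 i) =
      (∑ τ, ∏ i ∈ S τ, φ (τ i)) * (Fintype.card J : ℝ) ^ Fintype.card ι := by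
    rw [Fintype.sum_prod_type, sum_mul]
    refine sum_congr rfl fun τ _ => ?_
    rw [← hpart (S τ), mul_sum]
    refine sum_congr rfl fun σ _ => ?_
    have hprod : ∏ i ∈ S τ, φ (τ i) = ∏ i, if i ∈ S τ then φ (τ i) else 1 := by
      rw [prod_ite_mem, univ_inter]
    rw [hprod, ← prod_mul_distrib]
    refine prod_congr rfl fun i _ => ?_
    by_cases hi : i ∈ S τ <;> simp [mix, hi]
  have hr : ∑ p : (ι → J) × (ι → J), ∏ i, φ (p.1 i) =
      (Fintype.card J : ℝ) ^ Fintype.card ι * (Fintype.card J : ℝ) ^ Fintype.card ι := by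
    rw [Fintype.sum_prod_type]
    simp only [sum_const, card_univ, Fintype.card_pi, prod_const, nsmul_eq_mul]
    rw [← mul_sum, hall]
    push_cast
    ring
  rw [hl, hr] at hpair
  exact mul_right_cancel₀ (by positivity) hpair

/-- The run reads `τ` only at touched items; this is the stopping property required by
`sum_prod_of_stopping`. -/
lemma touched_eq_of_eqOn {υ : ℕ → U} {a : FinWorld U K ι J → ℕ → ι} {H : ℕ}
    (ha : Causal υ a H) (x : U → K) (X : K → J → Bool) (τ τ' : ι → J)
    (h : ∀ i ∈ touched a H (x, τ, X), τ' i = τ i) :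
    touched a H (x, τ', X) = touched a H (x, τ, X) := by
  unfold touched
  refine image_congr fun s hs => ?_
  rw [mem_coe, mem_range] at hs
  refine ha _ _ s hs fun t ht => ?_
  have := h (a (x, τ, X) t) (mem_image_of_mem _ (mem_range.2 (ht.trans hs)))
  simp [FinWorld.rate, this]

/-- The probability that few items are touched but many of them have the type `j`. -/
lemma card_load_le {υ : ℕ → U} {a : FinWorld U K ι J → ℕ → ι} {H : ℕ}
    (ha : Causal υ a H) [Nonempty J] (j : J) {n₀ β θ : ℝ} (hθ : 0 ≤ θ) :
    (#{w : FinWorld U K ι J | (#(touched a H w) : ℝ) ≤ n₀ ∧ β ≤ load a H w j} : ℝ) ≤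
      Real.exp (n₀ / Fintype.card J * (Real.exp θ - 1) - θ * β) *
        Fintype.card (FinWorld U K ι J) := by
  set q : ℝ := (Fintype.card J : ℝ) with hq
  have hq0 : 0 < q := by rw [hq]; exact_mod_cast Fintype.card_pos
  set ρ : ℝ := 1 + (Real.exp θ - 1) / q with hρ
  have hexp : 1 ≤ Real.exp θ := Real.one_le_exp hθ
  have hρ1 : 1 ≤ ρ := by
    have : 0 ≤ (Real.exp θ - 1) / q := div_nonneg (by linarith) hq0.le
    linarith
  have hρ0 : 0 < ρ := by linarith
  -- Exponential tilting of type `j`, normalised to mean `1`. The product over touched items is then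
  -- an exponential martingale stopped at the end of the run, and Markov's inequality bounds the
  -- event.
  let φ : J → ℝ := fun j' => (if j' = j then Real.exp θ else 1) / ρ
  have hφ : ∑ j', φ j' = Fintype.card J := by
    have : ∀ j', φ j' = (1 + if j' = j then Real.exp θ - 1 else 0) / ρ := by
      intro j'
      by_cases hj : j' = j <;> simp [φ, hj]
    simp only [this]
    rw [← sum_div, sum_add_distrib]
    simp only [sum_const, card_univ, nsmul_eq_mul, mul_one, sum_ite_eq', mem_univ, if_true]
    rw [← hq, div_eq_iff hρ0.ne', hρ]
    field_simp
  have hprod : ∀ w : FinWorld U K ι J, ∏ i ∈ touched a H w, φ (w.2.1 i) =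
      Real.exp (θ * load a H w j) / ρ ^ #(touched a H w) := by
    intro w
    simp only [φ]
    rw [prod_div_distrib, prod_const, prod_ite, prod_const, prod_const_one, mul_one,
      ← Real.exp_nat_mul, mul_comm]
    rfl
  have hsum : ∑ w : FinWorld U K ι J, Real.exp (θ * load a H w j) / ρ ^ #(touched a H w) =
      Fintype.card (FinWorld U K ι J) := by
    simp only [← hprod]
    rw [Fintype.sum_prod_type]
    simp only [Fintype.sum_prod_type]
    have : ∀ (x : U → K), ∑ τ : ι → J, ∑ X : K → J → Bool,
        ∏ i ∈ touched a H (x, τ, X), φ (τ i) =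
        ∑ X : K → J → Bool, (Fintype.card J : ℝ) ^ Fintype.card ι := by
      intro x
      rw [sum_comm]
      exact sum_congr rfl fun X _ =>
        sum_prod_of_stopping (S := fun τ => touched a H (x, τ, X))
          (fun τ τ' h => touched_eq_of_eqOn ha x X τ τ' h) hφ
    simp only [this, sum_const, card_univ, nsmul_eq_mul, Fintype.card_prod, Fintype.card_pi,
      prod_const]
    push_cast
    ring
  set ε := Real.exp (n₀ / q * (Real.exp θ - 1) - θ * β)
  have hpt : ∀ w : FinWorld U K ι J,
      (if (#(touched a H w) : ℝ) ≤ n₀ ∧ β ≤ load a H w j then (1 : ℝ) else 0) ≤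
      ε * (Real.exp (θ * load a H w j) / ρ ^ #(touched a H w)) := by
    intro w
    split_ifs with h
    · have h1 : ρ ^ #(touched a H w) ≤ Real.exp (n₀ / q * (Real.exp θ - 1)) := by
        calc ρ ^ #(touched a H w) ≤ (Real.exp ((Real.exp θ - 1) / q)) ^ #(touched a H w) := by
              gcongr
              rw [hρ, add_comm]
              exact Real.add_one_le_exp _
          _ = Real.exp (#(touched a H w) * ((Real.exp θ - 1) / q)) := by rw [Real.exp_nat_mul]
          _ ≤ _ := by
              rw [Real.exp_le_exp, div_mul_eq_mul_div, mul_div_assoc]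
              have : 0 ≤ (Real.exp θ - 1) / q := div_nonneg (by linarith) hq0.le
              exact mul_le_mul_of_nonneg_right h.1 this
      have h2 : Real.exp (θ * β) ≤ Real.exp (θ * load a H w j) := by
        rw [Real.exp_le_exp]
        exact mul_le_mul_of_nonneg_left h.2 hθ
      have h3 : 0 < ρ ^ #(touched a H w) := by positivity
      rw [← mul_div_assoc, le_div_iff₀ h3, one_mul]
      calc ρ ^ #(touched a H w) ≤ Real.exp (n₀ / q * (Real.exp θ - 1)) := h1
        _ = ε * Real.exp (θ * β) := by
            rw [← Real.exp_add]; congr 1; ring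
        _ ≤ _ := by gcongr
    · positivity
  rw [← hsum, mul_sum, ← sum_boole]
  exact sum_le_sum fun w _ => hpt w

end FiniteModel

section FiniteModel

open Finset

/-! #### Regularity of random preference matrices -/

section Regular

variable {K J : Type*} [DecidableEq K] [DecidableEq J] [Fintype K] [Fintype J]

lemma card_pattern (D E : Finset K) :
    (#{c : K → Bool | ∀ k ∈ D, (c k = true ↔ k ∈ E)} : ℝ) = 2 ^ Fintype.card K / 2 ^ #D := by
  have h : ({c : K → Bool | ∀ k ∈ D, (c k = true ↔ k ∈ E)} : Finset (K → Bool)) =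
      Fintype.piFinset fun k => if k ∈ D then {decide (k ∈ E)} else univ := by
    ext c
    simp only [mem_filter, mem_univ, true_and, Fintype.mem_piFinset]
    refine forall_congr' fun k => ?_
    by_cases hk : k ∈ D
    · simp only [hk, true_imp_iff, if_true, mem_singleton]
      cases c k <;> by_cases hE : k ∈ E <;> simp [hE]
    · simp [hk]
  rw [h, Fintype.card_piFinset]
  have h2 : ∀ k, #(if k ∈ D then {decide (k ∈ E)} else (univ : Finset Bool)) =
      if k ∈ D then 1 else 2 := by
    intro k
    split_ifs <;> simp
  simp only [h2]
  rw [prod_ite, prod_const_one, one_mul, prod_const, filter_not, filter_univ_mem,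
    ← compl_eq_univ_sdiff, card_compl, Nat.cast_pow, Nat.cast_ofNat,
    pow_sub₀ _ two_ne_zero (card_le_univ D), div_eq_mul_inv]

/-- The number of columns showing the pattern `E` in the rows `D`. -/
def patternCount (D E : Finset K) (X : K → J → Bool) : ℕ :=
  #{j | ∀ k ∈ D, (X k j = true ↔ k ∈ E)}

/-- The columns are independent, so the exponential moment factorises after transposing the matrix;
each column shows the pattern with probability `2 ^ (-#D)`. -/
lemma sum_exp_patternCount_le (D E : Finset K) (θ : ℝ) :
    ∑ X : K → J → Bool, Real.exp (θ * patternCount D E X) ≤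
      Real.exp (Fintype.card J / 2 ^ #D * (Real.exp θ - 1)) * Fintype.card (K → J → Bool) := by
  let g : (K → Bool) → ℝ := fun c => if ∀ k ∈ D, (c k = true ↔ k ∈ E) then Real.exp θ else 1
  have h1 : ∀ X : K → J → Bool, Real.exp (θ * patternCount D E X) = ∏ j, g fun k => X k j := by
    intro X
    simp only [g]
    rw [prod_ite, prod_const, prod_const_one, mul_one, ← Real.exp_nat_mul, mul_comm]
    rfl
  have h2 : ∑ X : K → J → Bool, ∏ j, g (fun k => X k j) = ∑ Y : J → K → Bool, ∏ j, g (Y j) :=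
    Fintype.sum_equiv (Equiv.piComm fun (_ : K) (_ : J) => Bool) _ _ fun X => rfl
  have h3 : ∑ Y : J → K → Bool, ∏ j, g (Y j) = (∑ c, g c) ^ Fintype.card J := by
    rw [← Fintype.piFinset_univ, ← prod_univ_sum (fun _ : J => (univ : Finset (K → Bool)))
      fun _ c => g c, prod_const, card_univ]
  have h4 : ∑ c, g c = 2 ^ Fintype.card K * (1 + (Real.exp θ - 1) / 2 ^ #D) := by
    have : ∀ c, g c = 1 + if ∀ k ∈ D, (c k = true ↔ k ∈ E) then Real.exp θ - 1 else 0 := by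
      intro c
      simp only [g]
      split_ifs <;> ring
    simp only [this]
    rw [sum_add_distrib, ← sum_filter, sum_const, sum_const, nsmul_eq_mul, nsmul_eq_mul,
      card_pattern]
    simp
    ring
  have h5 : 0 ≤ 1 + (Real.exp θ - 1) / 2 ^ #D := by
    have : (1 : ℝ) ≤ 2 ^ #D := one_le_pow₀ (by norm_num)
    have h6 : -1 ≤ (Real.exp θ - 1) / 2 ^ #D := by
      rw [le_div_iff₀ (by positivity)]
      nlinarith [Real.exp_pos θ]
    linarith
  simp only [h1]
  rw [h2, h3, h4, mul_pow]
  calc ((2 : ℝ) ^ Fintype.card K) ^ Fintype.card J *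
        (1 + (Real.exp θ - 1) / 2 ^ #D) ^ Fintype.card J
      ≤ ((2 : ℝ) ^ Fintype.card K) ^ Fintype.card J *
        (Real.exp ((Real.exp θ - 1) / 2 ^ #D)) ^ Fintype.card J := by
        gcongr
        rw [add_comm]
        exact Real.add_one_le_exp _
    _ = _ := by
        rw [← Real.exp_nat_mul, mul_comm]
        congr 1
        · congr 1; ring
        · simp [← pow_mul, mul_comm]

/-- Chernoff's bound with `θ = ± η / 2`, both tails at once: for `η > 0`, dividing the condition by
`θ` turns it into a deviation of `η` times the mean. The exponent is controlled by `exp θ - 1 ≤ θ +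
θ ^ 2`. -/
lemma card_patternCount_deviation_le (D E : Finset K) {η θ : ℝ} (hθ : |θ| ≤ 1)
    (hθη : θ ^ 2 = η ^ 2 / 4) :
    (#{X : K → J → Bool | θ * (Fintype.card J / 2 ^ #D) + η ^ 2 / 2 * (Fintype.card J / 2 ^ #D) ≤
      θ * patternCount D E X} : ℝ) ≤
      Real.exp (-(η ^ 2 / 4 * (Fintype.card J / 2 ^ #D))) * Fintype.card (K → J → Bool) := by
  set μ : ℝ := Fintype.card J / 2 ^ #D with hμ
  have hμ0 : 0 ≤ μ := by positivity
  have hexp : Real.exp θ - 1 ≤ θ + θ ^ 2 := by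
    have := (abs_le.1 (Real.abs_exp_sub_one_sub_id_le hθ)).2
    linarith
  have h1 : ∀ X : K → J → Bool, (if θ * μ + η ^ 2 / 2 * μ ≤ θ * patternCount D E X
      then (1 : ℝ) else 0) ≤
      Real.exp (-(θ * μ + η ^ 2 / 2 * μ)) * Real.exp (θ * patternCount D E X) := by
    intro X
    rw [← Real.exp_add]
    split_ifs with h
    · exact Real.one_le_exp (by linarith)
    · positivity
  rw [← sum_boole]
  refine (sum_le_sum fun X _ => h1 X).trans ?_
  rw [← mul_sum]
  calc _ ≤ Real.exp (-(θ * μ + η ^ 2 / 2 * μ)) *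
        (Real.exp (μ * (Real.exp θ - 1)) * Fintype.card (K → J → Bool)) := by
        gcongr
        exact sum_exp_patternCount_le D E θ
    _ = Real.exp (-(θ * μ + η ^ 2 / 2 * μ) + μ * (Real.exp θ - 1)) *
        Fintype.card (K → J → Bool) := by rw [Real.exp_add]; ring
    _ ≤ _ := by
        gcongr
        have := mul_le_mul_of_nonneg_left hexp hμ0
        rw [hθη] at this
        nlinarith

/-- A nonempty set of at most `r` elements is the range of some map from `Fin r`. -/
lemma card_small_finsets_le {r : ℕ} :
    #{D : Finset K | D.Nonempty ∧ #D ≤ r} ≤ Fintype.card K ^ r := by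
  have : ({D : Finset K | D.Nonempty ∧ #D ≤ r} : Finset (Finset K)) ⊆
      (univ : Finset (Fin r → K)).image fun f => univ.image f := by
    intro D hD
    obtain ⟨hne, hcard⟩ := (mem_filter.1 hD).2
    have : Nonempty D := hne.to_subtype
    obtain ⟨e⟩ := Function.Embedding.nonempty_of_card_le (α := D) (β := Fin r) (by simpa)
    refine mem_image.2 ⟨fun m => (Function.invFun e m : D), mem_univ _, ?_⟩
    ext k
    simp only [mem_image, mem_univ, true_and]
    constructor
    · rintro ⟨m, rfl⟩
      exact (Function.invFun e m).2
    · intro hk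
      obtain ⟨m, hm⟩ := Function.invFun_surjective e.injective ⟨k, hk⟩
      exact ⟨m, by rw [hm]⟩
  refine (card_le_card this).trans (card_image_le.trans ?_)
  simp

open Classical in
/-- A random preference matrix is regular with high probability. -/
lemma card_not_regular_le (r : ℕ) {η : ℝ} (hη0 : 0 ≤ η) (hη1 : η ≤ 1) :
    (#{X : K → J → Bool | ¬ RegularMatrix r η X} : ℝ) ≤
      2 * (2 * Fintype.card K) ^ r * Real.exp (-(η ^ 2 / 4 * (Fintype.card J / 2 ^ r))) *
        Fintype.card (K → J → Bool) := by
  set C : ℝ := (Fintype.card (K → J → Bool) : ℝ)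
  let dev : ℝ → Finset K → Finset K → Finset (K → J → Bool) := fun θ D E =>
    {X : K → J → Bool | θ * (Fintype.card J / 2 ^ #D) + η ^ 2 / 2 * (Fintype.card J / 2 ^ #D) ≤
      θ * patternCount D E X}
  let 𝒟 : Finset (Finset K) := {D : Finset K | D.Nonempty ∧ #D ≤ r}
  have hsub : ({X : K → J → Bool | ¬ RegularMatrix r η X} : Finset (K → J → Bool)) ⊆
      𝒟.biUnion fun D => D.powerset.biUnion fun E => dev (η / 2) D E ∪ dev (-(η / 2)) D E := by
    intro X hX
    have hX := (mem_filter.1 hX).2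
    unfold RegularMatrix at hX
    push Not at hX
    obtain ⟨D, hD, E, hE, h⟩ := hX
    -- For `D = ∅` every column shows the pattern, so there is no deviation.
    have hne : D.Nonempty := by
      by_contra hn
      rw [not_nonempty_iff_eq_empty] at hn
      subst hn
      simp at h
      have : 0 ≤ η * Fintype.card J := by positivity
      linarith
    refine mem_biUnion.2 ⟨D, mem_filter.2 ⟨mem_univ _, hne, hD⟩, mem_biUnion.2 ⟨E,
      mem_powerset.2 hE, ?_⟩⟩
    have hcount : (#{j | ∀ k ∈ D, (X k j = true ↔ k ∈ E)} : ℝ) = patternCount D E X := by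
      unfold patternCount
      congr!
    rw [hcount, lt_abs] at h
    rw [mem_union]
    rcases h with h | h
    · left
      refine mem_filter.2 ⟨mem_univ _, ?_⟩
      nlinarith
    · right
      refine mem_filter.2 ⟨mem_univ _, ?_⟩
      nlinarith
  have hη2 : |η / 2| ≤ 1 := by rw [abs_of_nonneg (by linarith)]; linarith
  have hdev : ∀ D ∈ 𝒟, ∀ E, (#(dev (η / 2) D E ∪ dev (-(η / 2)) D E) : ℝ) ≤
      2 * (Real.exp (-(η ^ 2 / 4 * (Fintype.card J / 2 ^ r))) * C) := by
    intro D hD E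
    have hr : #D ≤ r := (mem_filter.1 hD).2.2
    have hmono : Real.exp (-(η ^ 2 / 4 * (Fintype.card J / 2 ^ #D))) ≤
        Real.exp (-(η ^ 2 / 4 * (Fintype.card J / 2 ^ r))) := by
      rw [Real.exp_le_exp]
      apply neg_le_neg
      gcongr
      norm_num
    have h1 := card_patternCount_deviation_le (J := J) D E (η := η) (θ := η / 2) hη2 (by ring)
    have h2 := card_patternCount_deviation_le (J := J) D E (η := η) (θ := -(η / 2))
      (by rwa [abs_neg]) (by ring)
    have h3 : (#(dev (η / 2) D E ∪ dev (-(η / 2)) D E) : ℝ) ≤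
        #(dev (η / 2) D E) + #(dev (-(η / 2)) D E) := by exact_mod_cast card_union_le _ _
    have h4 : Real.exp (-(η ^ 2 / 4 * (Fintype.card J / 2 ^ #D))) * C ≤
        Real.exp (-(η ^ 2 / 4 * (Fintype.card J / 2 ^ r))) * C := by gcongr
    calc _ ≤ _ := h3
      _ ≤ _ := add_le_add h1 h2
      _ ≤ _ := by linarith
  set ε := Real.exp (-(η ^ 2 / 4 * (Fintype.card J / 2 ^ r))) * C
  have hε : 0 ≤ ε := by positivity
  calc (#{X : K → J → Bool | ¬ RegularMatrix r η X} : ℝ)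
      ≤ ∑ D ∈ 𝒟, ∑ E ∈ D.powerset, (#(dev (η / 2) D E ∪ dev (-(η / 2)) D E) : ℝ) := by
        refine le_trans (Nat.cast_le.2 ((card_le_card hsub).trans card_biUnion_le)) ?_
        push_cast
        refine sum_le_sum fun D _ => ?_
        exact_mod_cast card_biUnion_le
    _ ≤ ∑ D ∈ 𝒟, 2 ^ r * (2 * ε) := by
        refine sum_le_sum fun D hD => ?_
        refine (sum_le_sum fun E _ => hdev D hD E).trans ?_
        rw [sum_const, card_powerset, nsmul_eq_mul]
        push_cast
        gcongr
        · norm_num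
        · exact (mem_filter.1 hD).2.2
    _ = #𝒟 * (2 ^ r * (2 * ε)) := by rw [sum_const, nsmul_eq_mul]
    _ ≤ (Fintype.card K : ℝ) ^ r * (2 ^ r * (2 * ε)) := by
        gcongr
        exact_mod_cast card_small_finsets_le
    _ = _ := by
        simp only [ε]
        rw [mul_pow]
        ring

end Regular

/-! #### The number of distinct user types -/

section Occupancy

variable {U K : Type*} [DecidableEq U] [DecidableEq K] [Fintype U] [Fintype K]

lemma card_avoiding (A : Finset K) :
    #{x : U → K | ∀ k ∈ A, ∀ u, x u ≠ k} = (Fintype.card K - #A) ^ Fintype.card U := by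
  have : ({x : U → K | ∀ k ∈ A, ∀ u, x u ≠ k} : Finset (U → K)) = Fintype.piFinset fun _ => Aᶜ := by
    ext x
    simp only [mem_filter, mem_univ, true_and, Fintype.mem_piFinset, mem_compl]
    exact ⟨fun h u hu => h _ hu u rfl, fun h k hk u e => h u (e ▸ hk)⟩
  rw [this, Fintype.card_piFinset, prod_const, card_univ, card_compl]

/-- A variance bound for the proportion of missing types. The indicators `Z k` are negatively
correlated because `1 - 2 / N ≤ (1 - 1 / N) ^ 2`, so only the diagonal contributes. -/
lemma sum_sq_missing_types_le {N : ℕ} (hU : Fintype.card U = N) (hK : Fintype.card K = N)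
    (hN : 2 ≤ N) :
    ∑ x : U → K, (1 - (#(univ.image x) : ℝ) / N - (1 - 1 / (N : ℝ)) ^ N) ^ 2 ≤
      (1 - 1 / (N : ℝ)) ^ N / N * (N : ℝ) ^ N := by
  set m : ℝ := (1 - 1 / (N : ℝ)) ^ N with hm
  have hN0 : (0 : ℝ) < N := by positivity
  have hN2 : (2 : ℝ) ≤ N := by exact_mod_cast hN
  let Z : K → (U → K) → ℝ := fun k x => if ∀ u, x u ≠ k then 1 else 0
  have hY : ∀ x : U → K, 1 - (#(univ.image x) : ℝ) / N = (∑ k, Z k x) / N := by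
    intro x
    simp only [Z]
    rw [sum_boole]
    have h1 : #{k | ∀ u, x u ≠ k} + #(univ.image x) = N := by
      rw [← hK, ← card_compl_add_card (univ.image x)]
      congr 2
      ext k
      simp
    rw [eq_div_iff hN0.ne', sub_mul, div_mul_cancel₀ _ hN0.ne', one_mul, sub_eq_iff_eq_add]
    exact_mod_cast h1.symm
  have hm0 : 0 ≤ m := by
    apply pow_nonneg
    rw [sub_nonneg, div_le_one hN0]; linarith
  have e1 : ∀ k, ∑ x : U → K, Z k x = m * (N : ℝ) ^ N := by
    intro k
    have := card_avoiding (U := U) ({k} : Finset K)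
    simp only [Z]
    rw [sum_boole]
    simp only [mem_singleton, forall_eq, card_singleton] at this
    rw [this, hU, hK, hm, ← mul_pow, Nat.cast_pow, Nat.cast_sub (by omega)]
    congr 1
    field_simp
    simp
  have e2 : ∀ k k', k ≠ k' → ∑ x : U → K, Z k x * Z k' x ≤ m ^ 2 * (N : ℝ) ^ N := by
    intro k k' hkk
    have := card_avoiding (U := U) ({k, k'} : Finset K)
    have h2 : ∀ x : U → K, Z k x * Z k' x =
        if ∀ k₁ ∈ ({k, k'} : Finset K), ∀ u, x u ≠ k₁ then (1 : ℝ) else 0 := by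
      intro x
      simp only [Z, mem_insert, mem_singleton, forall_eq_or_imp, forall_eq]
      by_cases ha : ∀ u, x u ≠ k <;> by_cases hb : ∀ u, x u ≠ k' <;> simp [ha, hb]
    simp only [h2]
    rw [sum_boole, this, hU, hK, card_pair hkk, hm, ← pow_mul, mul_comm N 2, pow_mul, ← mul_pow,
      Nat.cast_pow, Nat.cast_sub hN]
    have : (0 : ℝ) ≤ N - (2 : ℕ) := by push_cast; linarith
    gcongr
    have : (1 - 1 / (N : ℝ)) ^ 2 * N = N - 2 + 1 / N := by field_simp; ring
    rw [this]
    push_cast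
    have : (0 : ℝ) ≤ 1 / N := by positivity
    linarith
  have e3 : ∀ k x, Z k x * Z k x = Z k x := by
    intro k x
    simp only [Z]; split_ifs <;> simp
  have S1 : ∑ x : U → K, ∑ k, Z k x = N * (m * (N : ℝ) ^ N) := by
    rw [sum_comm, sum_congr rfl fun k _ => e1 k, sum_const, card_univ, hK, nsmul_eq_mul]
  have S2 : ∑ x : U → K, (∑ k, Z k x) ^ 2 ≤
      N * (m * (N : ℝ) ^ N) + N ^ 2 * (m ^ 2 * (N : ℝ) ^ N) := by
    have h1 : ∀ x : U → K, (∑ k, Z k x) ^ 2 = ∑ k, ∑ k', Z k x * Z k' x := by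
      intro x
      rw [sq, sum_mul_sum]
    simp only [h1]
    rw [sum_comm]
    have h2 : ∀ k, ∑ x : U → K, ∑ k', Z k x * Z k' x ≤
        m * (N : ℝ) ^ N + N * (m ^ 2 * (N : ℝ) ^ N) := by
      intro k
      rw [sum_comm, ← add_sum_erase _ _ (mem_univ k)]
      have h3 : ∑ x : U → K, Z k x * Z k x = m * (N : ℝ) ^ N := by
        simp only [e3]; exact e1 k
      rw [h3]
      gcongr
      refine (sum_le_sum (g := fun _ => m ^ 2 * (N : ℝ) ^ N) fun k' hk' =>
        e2 k k' (ne_of_mem_erase hk').symm).trans ?_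
      rw [sum_const, nsmul_eq_mul]
      gcongr
      rw [← hK]
      exact card_le_univ _
    refine (sum_le_sum fun k _ => h2 k).trans (le_of_eq ?_)
    rw [sum_const, card_univ, hK, nsmul_eq_mul]
    ring
  have hexp : ∀ x : U → K, (1 - (#(univ.image x) : ℝ) / N - m) ^ 2 =
      (∑ k, Z k x) ^ 2 / N ^ 2 - 2 * m / N * (∑ k, Z k x) + m ^ 2 := by
    intro x
    rw [hY]
    ring
  simp only [hexp]
  rw [sum_add_distrib, sum_sub_distrib, ← sum_div, ← mul_sum, S1, sum_const, card_univ,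
    Fintype.card_pi, prod_const, card_univ, hK, hU, nsmul_eq_mul]
  have h5 : (∑ x : U → K, (∑ k, Z k x) ^ 2) / N ^ 2 ≤
      m * (N : ℝ) ^ N / N + m ^ 2 * (N : ℝ) ^ N := by
    rw [div_le_iff₀ (by positivity)]
    refine S2.trans (le_of_eq ?_)
    field_simp
  have h6 : 2 * m / N * (N * (m * (N : ℝ) ^ N)) = 2 * m ^ 2 * (N : ℝ) ^ N := by
    field_simp
  rw [h6]
  push_cast
  have h7 : m / N * (N : ℝ) ^ N = m * (N : ℝ) ^ N / N := by ring
  rw [h7]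
  linarith

lemma one_sub_inv_pow_le {N : ℕ} (hN : 1 ≤ N) : (1 - 1 / (N : ℝ)) ^ N ≤ 37 / 100 := by
  have hN0 : (1 : ℝ) ≤ N := by exact_mod_cast hN
  have h0 : 0 ≤ 1 - 1 / (N : ℝ) := by
    rw [sub_nonneg, div_le_one (by linarith)]; exact hN0
  calc (1 - 1 / (N : ℝ)) ^ N ≤ (Real.exp (-(1 / (N : ℝ)))) ^ N := by
        gcongr
        linarith [Real.add_one_le_exp (-(1 / (N : ℝ)))]
    _ = Real.exp (-1) := by
        rw [← Real.exp_nat_mul]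
        congr 1
        field_simp
    _ ≤ 37 / 100 := by
        rw [Real.exp_neg, inv_le_comm₀ (Real.exp_pos _) (by norm_num)]
        have := Real.exp_one_gt_d9
        norm_num at this ⊢
        linarith

/-- The number of distinct user types is about `0.63 N`, hence rarely below `0.55 N`. -/
lemma le_sum_min_types {N : ℕ} (hU : Fintype.card U = N) (hK : Fintype.card K = N)
    (hN : 2 ≤ N) :
    (1 - 11 / 5 / (N : ℝ)) * (N : ℝ) ^ N ≤
      ∑ x : U → K, min 1 ((#(univ.image x) : ℝ) / N / (11 / 20)) := by
  set m : ℝ := (1 - 1 / (N : ℝ)) ^ N with hm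
  have hm1 : m ≤ 37 / 100 := one_sub_inv_pow_le (by omega)
  have hN0 : (0 : ℝ) < N := by positivity
  -- A parabola below the truncated line lets the second moment suffice. For `m = 0.37` and slope
  -- `20 / 11` it touches the line at deviation `4 / 25`, which determines `125 / 22`; then `125 /
  -- 22 * 0.37 ≤ 11 / 5`.
  have hpt : ∀ x : U → K, 1 - 125 / 22 * (1 - (#(univ.image x) : ℝ) / N - m) ^ 2 ≤
      min 1 ((#(univ.image x) : ℝ) / N / (11 / 20)) := by
    intro x
    set y := (#(univ.image x) : ℝ) / N
    refine le_min ?_ ?_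
    · nlinarith [sq_nonneg (1 - y - m)]
    · rw [le_div_iff₀ (by norm_num)]
      nlinarith [sq_nonneg (1 - y - m - 2 * (2 / 25))]
  refine le_trans ?_ (sum_le_sum fun x _ => hpt x)
  rw [sum_sub_distrib, ← mul_sum, sum_const, card_univ, Fintype.card_pi, prod_const, card_univ, hK,
    hU, nsmul_eq_mul]
  have h1 := sum_sq_missing_types_le hU hK hN
  rw [← hm] at h1
  have h2 : m / N * (N : ℝ) ^ N ≤ 37 / 100 / N * (N : ℝ) ^ N := by gcongr
  have h3 : (0 : ℝ) ≤ (N : ℝ) ^ N / N := by positivity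
  push_cast
  have h4 : 37 / 100 / N * (N : ℝ) ^ N = 37 / 100 * ((N : ℝ) ^ N / N) := by ring
  have h5 : 11 / 5 / (N : ℝ) * (N : ℝ) ^ N = 11 / 5 * ((N : ℝ) ^ N / N) := by ring
  rw [sub_mul, h5]
  linarith

end Occupancy

end FiniteModel

section FiniteModel

open Finset

/-! #### Lower bounds on the number of disliked recommendations -/

variable {U K ι J : Type*} [DecidableEq U] [DecidableEq K] [DecidableEq ι] [DecidableEq J]
  [Fintype U] [Fintype K] [Fintype ι] [Fintype J]

/-- The proportion of distinct user types, relative to `0.55` and truncated at `1`. -/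
noncomputable def typeShare (N : ℕ) (w : FinWorld U K ι J) : ℝ :=
  min 1 ((#(univ.image w.1) : ℝ) / N / (11 / 20))

lemma typeShare_nonneg (N : ℕ) (w : FinWorld U K ι J) : 0 ≤ typeShare N w := by
  unfold typeShare; positivity

lemma typeShare_le_one (N : ℕ) (w : FinWorld U K ι J) : typeShare N w ≤ 1 := min_le_left _ _

lemma typeShare_mul_le {N : ℕ} (hN : 2 ≤ N) (w : FinWorld U K ι J) :
    11 / 20 * N * typeShare N w ≤ #(univ.image w.1) := by
  have hN0 : (0 : ℝ) < N := by positivity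
  have h : typeShare N w ≤ (#(univ.image w.1) : ℝ) / N / (11 / 20) := min_le_right _ _
  rw [le_div_iff₀ (by norm_num), le_div_iff₀ hN0] at h
  linarith

lemma le_sum_typeShare {N : ℕ} (hU : Fintype.card U = N) (hK : Fintype.card K = N)
    (hN : 2 ≤ N) :
    (1 - 11 / 5 / (N : ℝ)) * Fintype.card (FinWorld U K ι J) ≤
      ∑ w : FinWorld U K ι J, typeShare N w := by
  unfold typeShare
  rw [Fintype.sum_prod_type]
  simp only [sum_const, card_univ, nsmul_eq_mul]
  rw [← mul_sum, mul_comm (Fintype.card _ : ℝ)]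
  have h := le_sum_min_types (U := U) (K := K) hU hK hN
  calc (1 - 11 / 5 / (N : ℝ)) * Fintype.card (FinWorld U K ι J)
      = (1 - 11 / 5 / (N : ℝ)) * (N : ℝ) ^ N * Fintype.card ((ι → J) × (K → J → Bool)) := by
        rw [Fintype.card_prod (U → K), Fintype.card_fun, hU, hK]
        push_cast
        ring
    _ ≤ _ := by gcongr

open Classical in
lemma sum_not_regular_le {r : ℕ} {η p : ℝ}
    (hp : (#{X : K → J → Bool | ¬ RegularMatrix r η X} : ℝ) ≤ p * Fintype.card (K → J → Bool)) :
    ∑ w : FinWorld U K ι J, (if RegularMatrix r η w.2.2 then (0 : ℝ) else 1) ≤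
      p * Fintype.card (FinWorld U K ι J) := by
  simp only [Fintype.sum_prod_type]
  have : ∑ X : K → J → Bool, (if RegularMatrix r η X then (0 : ℝ) else 1) ≤
      p * Fintype.card (K → J → Bool) := by
    refine le_trans (le_of_eq ?_) hp
    rw [← sum_boole]
    refine sum_congr rfl fun X _ => ?_
    split_ifs <;> simp_all
  refine (sum_le_sum fun x _ => sum_le_sum fun τ _ => this).trans (le_of_eq ?_)
  simp only [sum_const, card_univ, nsmul_eq_mul]
  rw [Fintype.card_prod, Fintype.card_prod]
  push_cast
  ring

open Classical in
/-- The lower bound from fresh recommendations alone. -/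
lemma Fair.le_sum_badCount_of_fresh {υ : ℕ → U} {a : FinWorld U K ι J → ℕ → ι} {H T N : ℕ}
    (ha : Causal υ a H) (hf : Fair υ a H T) [Nonempty J] (hU : Fintype.card U = N)
    (hK : Fintype.card K = N) (hN : 2 ≤ N) {r : ℕ} (hr : 2 * r ≤ N) {η p : ℝ} (hη0 : 0 ≤ η)
    (hη1 : η ≤ 1)
    (hp : (#{X : K → J → Bool | ¬ RegularMatrix r η X} : ℝ) ≤ p * Fintype.card (K → J → Bool)) :
    (1 - η) / (2 * (1 + η)) * (r * T * (1 - 11 / 5 / N - p)) *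
      Fintype.card (FinWorld U K ι J) ≤ ∑ w, (badCount υ a H w : ℝ) := by
  refine le_trans ?_ (sum_freshCount_le ha (r := r) hη0)
  have hc : 0 ≤ (1 - η) / (2 * (1 + η)) := div_nonneg (by linarith) (by linarith)
  rw [mul_assoc]
  refine mul_le_mul_of_nonneg_left ?_ hc
  have h1 := le_sum_typeShare (ι := ι) (J := J) hU hK hN
  have h2 := sum_not_regular_le (U := U) (ι := ι) hp
  have hpt : ∀ w : FinWorld U K ι J,
      r * T * (typeShare N w - if RegularMatrix r η w.2.2 then (0 : ℝ) else 1) ≤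
      if RegularMatrix r η w.2.2 then (freshCount υ a r H w : ℝ) else 0 := by
    intro w
    split_ifs with h
    · have h3 := hf.min_mul_le_freshCount r w
      have h4 : (r : ℝ) * typeShare N w ≤ (min r #(univ.image w.1) : ℕ) := by
        rw [Nat.cast_min]
        refine le_min ?_ ?_
        · exact mul_le_of_le_one_right (Nat.cast_nonneg _) (typeShare_le_one N w)
        · refine le_trans ?_ (typeShare_mul_le hN w)
          -- Since `r ≤ N / 2 ≤ 0.55 N`, the truncation in `typeShare` is compatible with `min r`.
          have : (2 * r : ℝ) ≤ N := by exact_mod_cast hr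
          exact mul_le_mul_of_nonneg_right (by linarith) (typeShare_nonneg N w)
      calc r * T * (typeShare N w - 0) = r * typeShare N w * T := by ring
        _ ≤ (min r #(univ.image w.1) : ℕ) * T := by gcongr
        _ ≤ _ := by exact_mod_cast h3
    · have := typeShare_le_one N w
      exact mul_nonpos_of_nonneg_of_nonpos (by positivity) (by linarith)
  refine le_trans ?_ (sum_le_sum fun w _ => hpt w)
  rw [← mul_sum, sum_sub_distrib, mul_assoc]
  gcongr
  linarith

open Classical in
/-- The probability that few items are touched but some item type is overloaded. -/
lemma sum_overload_le {υ : ℕ → U} {a : FinWorld U K ι J → ℕ → ι} {H : ℕ}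
    (ha : Causal υ a H) [Nonempty J] {n₀ β θ ε : ℝ} (hθ : 0 ≤ θ)
    (hε : Fintype.card J * Real.exp (n₀ / Fintype.card J * (Real.exp θ - 1) - θ * β) ≤ ε) :
    ∑ w : FinWorld U K ι J, (if ∃ j, (#(touched a H w) : ℝ) ≤ n₀ ∧ β ≤ load a H w j
      then (1 : ℝ) else 0) ≤ ε * Fintype.card (FinWorld U K ι J) := by
  rw [sum_boole]
  have hsub : ({w | ∃ j, (#(touched a H w) : ℝ) ≤ n₀ ∧ β ≤ load a H w j} :
      Finset (FinWorld U K ι J)) ⊆ univ.biUnion fun j =>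
        {w | (#(touched a H w) : ℝ) ≤ n₀ ∧ β ≤ load a H w j} := by
    intro w hw
    obtain ⟨j, hj⟩ := (mem_filter.1 hw).2
    exact mem_biUnion.2 ⟨j, mem_univ _, mem_filter.2 ⟨mem_univ _, hj⟩⟩
  calc _ ≤ ((∑ j, #{w : FinWorld U K ι J | (#(touched a H w) : ℝ) ≤ n₀ ∧ β ≤ load a H w j} :
        ℕ) : ℝ) := Nat.cast_le.2 ((card_le_card hsub).trans card_biUnion_le)
    _ ≤ ∑ j : J, Real.exp (n₀ / Fintype.card J * (Real.exp θ - 1) - θ * β) *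
        Fintype.card (FinWorld U K ι J) := by
        push_cast
        refine sum_le_sum fun j _ => le_trans (le_of_eq ?_) (card_load_le ha j hθ)
        congr!
    _ ≤ _ := by
        rw [sum_const, card_univ, nsmul_eq_mul, ← mul_assoc]
        gcongr

lemma half_sum_visited_le {υ : ℕ → U} {a : FinWorld U K ι J → ℕ → ι} {H : ℕ}
    (ha : Causal υ a H) :
    1 / 2 * ∑ w, (#(visited υ a H w) : ℝ) ≤ ∑ w, (badCount υ a H w : ℝ) := by
  have h := sum_card_visited_le ha
  have : ∑ w, (#(visited υ a H w) : ℝ) ≤ 2 * ∑ w, (badCount υ a H w : ℝ) := by exact_mod_cast h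
  linarith

open Classical in
/-- The trade-off between touching new items and visiting new pairs. -/
lemma Fair.le_sum_badCount_of_load {υ : ℕ → U} {a : FinWorld U K ι J → ℕ → ι} {H T N : ℕ}
    (ha : Causal υ a H) (hf : Fair υ a H T) [Nonempty J] (hU : Fintype.card U = N)
    (hK : Fintype.card K = N) (hN : 2 ≤ N) {r : ℕ} (hr : 1 ≤ r) {η p : ℝ} (hη0 : 0 ≤ η)
    (hη1 : η ≤ 1)
    (hp : (#{X : K → J → Bool | ¬ RegularMatrix r η X} : ℝ) ≤ p * Fintype.card (K → J → Bool))
    {n₀ β θ ε : ℝ} (hn₀ : 0 ≤ n₀) (hβ : 0 < β) (hnβ : β * n₀ ≤ 11 / 20 * (N * T)) (hθ : 0 ≤ θ)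
    (hε : Fintype.card J * Real.exp (n₀ / Fintype.card J * (Real.exp θ - 1) - θ * β) ≤ ε) :
    (1 - η) / (4 * (1 + η)) * (n₀ * (1 - 11 / 5 / N - p - ε)) *
      Fintype.card (FinWorld U K ι J) ≤ ∑ w, (badCount υ a H w : ℝ) := by
  set c := (1 - η) / (2 * (1 + η)) with hc_def
  have hc : 0 ≤ c := div_nonneg (by linarith) (by linarith)
  have hc2 : c ≤ 1 / 2 := by
    rw [hc_def, div_le_iff₀ (by linarith)]; linarith
  have hc4 : (1 - η) / (4 * (1 + η)) = c / 2 := by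
    rw [hc_def]; field_simp; norm_num
  have h1 := le_sum_typeShare (ι := ι) (J := J) hU hK hN
  have h2 := sum_not_regular_le (U := U) (ι := ι) hp
  have h3 := sum_overload_le ha hθ hε
  have h4 := sum_freshCount_le ha (r := r) hη0
  rw [← hc_def] at h4
  have h5 : c * ∑ w, (#(visited υ a H w) : ℝ) ≤ ∑ w, (badCount υ a H w : ℝ) :=
    le_trans (mul_le_mul_of_nonneg_right hc2 (sum_nonneg fun w _ => Nat.cast_nonneg _)) (half_sum_visited_le ha)
  -- Outside the exceptional events, either more than `n₀` items are touched and freshness pays, or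
  -- all loads are at most `β` and visited pairs pay. Adding the two bounds instead of taking their
  -- maximum costs the factor `2` in the constant.
  have hpt : ∀ w : FinWorld U K ι J,
      n₀ * (typeShare N w - (if RegularMatrix r η w.2.2 then (0 : ℝ) else 1) -
        if ∃ j, (#(touched a H w) : ℝ) ≤ n₀ ∧ β ≤ load a H w j then (1 : ℝ) else 0) ≤
      (if RegularMatrix r η w.2.2 then (freshCount υ a r H w : ℝ) else 0) +
        #(visited υ a H w) := by
    intro w
    have hs1 := typeShare_le_one N w
    by_cases hreg : RegularMatrix r η w.2.2
    swap
    · simp only [hreg, if_false]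
      refine le_trans (mul_nonpos_of_nonneg_of_nonpos hn₀ ?_) (by positivity)
      split_ifs <;> linarith
    by_cases hov : ∃ j, (#(touched a H w) : ℝ) ≤ n₀ ∧ β ≤ load a H w j
    · simp only [hreg, hov, if_true]
      exact le_trans (mul_nonpos_of_nonneg_of_nonpos hn₀ (by linarith)) (by positivity)
    simp only [hreg, hov, if_true, if_false, sub_zero]
    rcases le_total (#(touched a H w) : ℝ) n₀ with hle | hge
    · have hload : ∀ j, (load a H w j : ℝ) ≤ β := by
        intro j
        by_contra hj
        exact hov ⟨j, hle, (not_le.1 hj).le⟩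
      have h6 := hf.card_mul_le_mul_card_visited w hload
      have h7 := typeShare_mul_le hN w
      have h8 : n₀ * typeShare N w ≤ #(visited υ a H w) := by
        refine le_of_mul_le_mul_left ?_ hβ
        calc β * (n₀ * typeShare N w) = β * n₀ * typeShare N w := by ring
          _ ≤ 11 / 20 * (N * T) * typeShare N w :=
            mul_le_mul_of_nonneg_right hnβ (typeShare_nonneg N w)
          _ = 11 / 20 * N * typeShare N w * T := by ring
          _ ≤ #(univ.image w.1) * T := mul_le_mul_of_nonneg_right h7 (Nat.cast_nonneg _)
          _ ≤ _ := h6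
      have : (0 : ℝ) ≤ freshCount υ a r H w := Nat.cast_nonneg _
      linarith
    · have h6 : (#(touched a H w) : ℝ) ≤ freshCount υ a r H w := by
        exact_mod_cast card_touched_le_freshCount υ a hr H w
      have h7 : n₀ * typeShare N w ≤ n₀ := mul_le_of_le_one_right hn₀ hs1
      have : (0 : ℝ) ≤ #(visited υ a H w) := Nat.cast_nonneg _
      linarith
  have h6 := sum_le_sum fun w (_ : w ∈ (univ : Finset (FinWorld U K ι J))) => hpt w
  rw [← mul_sum, sum_sub_distrib, sum_sub_distrib, sum_add_distrib] at h6
  have h7 : n₀ * ((1 - 11 / 5 / N - p - ε) * Fintype.card (FinWorld U K ι J)) ≤ _ :=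
    le_trans (mul_le_mul_of_nonneg_left (by linarith) hn₀) h6
  have h8 := mul_le_mul_of_nonneg_left h7 hc
  rw [hc4]
  linarith

/-- If hardly any item type is recommended more than `b` times, many pairs are visited. -/
lemma Fair.le_sum_badCount_of_light {υ : ℕ → U} {a : FinWorld U K ι J → ℕ → ι} {H T N : ℕ}
    (ha : Causal υ a H) (hf : Fair υ a H T) [Nonempty J] (hU : Fintype.card U = N)
    (hK : Fintype.card K = N) (hN : 2 ≤ N) {b : ℕ} (hb : 1 ≤ b) {θ ε : ℝ} (hθ : 0 ≤ θ)
    (hε : Fintype.card J * Real.exp (H / Fintype.card J * (Real.exp θ - 1) - θ * (b + 1)) ≤ ε) :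
    11 / 40 * (N * T / b) * (1 - 11 / 5 / N - ε) *
      Fintype.card (FinWorld U K ι J) ≤ ∑ w, (badCount υ a H w : ℝ) := by
  classical
  have h1 := le_sum_typeShare (ι := ι) (J := J) hU hK hN
  have h3 := sum_overload_le ha hθ hε
  have h5 := half_sum_visited_le ha
  have hb0 : (0 : ℝ) < b := by exact_mod_cast hb
  have hpt : ∀ w : FinWorld U K ι J,
      11 / 20 * (N * T / b) * (typeShare N w -
        if ∃ j, (#(touched a H w) : ℝ) ≤ H ∧ (b + 1 : ℝ) ≤ load a H w j then (1 : ℝ) else 0) ≤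
        #(visited υ a H w) := by
    intro w
    have hs1 := typeShare_le_one N w
    by_cases hov : ∃ j, (#(touched a H w) : ℝ) ≤ H ∧ (b + 1 : ℝ) ≤ load a H w j
    · simp only [hov, if_true]
      exact le_trans (mul_nonpos_of_nonneg_of_nonpos (by positivity) (by linarith)) (by positivity)
    simp only [hov, if_false, sub_zero]
    have hload : ∀ j, (load a H w j : ℝ) ≤ b := by
      intro j
      by_contra hj
      refine hov ⟨j, ?_, ?_⟩
      -- With `n₀ = H` the restriction to few touched items is automatic.
      · have : #(touched a H w) ≤ H := card_image_le.trans (by simp)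
        exact_mod_cast this
      · have : b < load a H w j := by exact_mod_cast not_le.1 hj
        exact_mod_cast this
    have h6 := hf.card_mul_le_mul_card_visited w hload
    have h7 := typeShare_mul_le hN w
    refine le_of_mul_le_mul_left ?_ hb0
    calc b * (11 / 20 * (N * T / b) * typeShare N w)
        = 11 / 20 * N * typeShare N w * T := by field_simp
      _ ≤ #(univ.image w.1) * T := mul_le_mul_of_nonneg_right h7 (Nat.cast_nonneg _)
      _ ≤ _ := h6
  have h6 := sum_le_sum fun w (_ : w ∈ (univ : Finset (FinWorld U K ι J))) => hpt w
  rw [← mul_sum, sum_sub_distrib] at h6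
  have h7 : 11 / 20 * (N * T / b : ℝ) *
      ((1 - 11 / 5 / N - ε) * Fintype.card (FinWorld U K ι J)) ≤ _ :=
    le_trans (mul_le_mul_of_nonneg_left (by linarith) (by positivity)) h6
  linarith

/-- Recommendations made without any knowledge are disliked with probability `1 / 2`. -/
lemma le_sum_badCount_of_const {υ : ℕ → U} {a : FinWorld U K ι J → ℕ → ι} {H N : ℕ}
    (hNH : N ≤ H) (hfirst : ∀ s < N, ∀ w w', a w s = a w' s) :
    (N : ℝ) / 2 * Fintype.card (FinWorld U K ι J) ≤ ∑ w, (badCount υ a H w : ℝ) := by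
  -- Negating the whole matrix swaps likes and dislikes but leaves the first `N` recommendations
  -- unchanged.
  let neg : FinWorld U K ι J → FinWorld U K ι J := fun w => (w.1, w.2.1, fun k j => !(w.2.2 k j))
  have hneg : Function.Involutive neg := fun w => by simp [neg]
  have hs : ∀ s < N, ∑ w : FinWorld U K ι J, (if w.rate (υ s) (a w s) = false then (1 : ℝ) else 0) =
      1 / 2 * Fintype.card (FinWorld U K ι J) := by
    intro s hs
    have e1 : ∑ w : FinWorld U K ι J, (if w.rate (υ s) (a w s) = false then (1 : ℝ) else 0) =
        ∑ w : FinWorld U K ι J, (if w.rate (υ s) (a w s) = false then (0 : ℝ) else 1) := by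
      refine Fintype.sum_equiv hneg.toPerm _ _ fun w => ?_
      simp only [Function.Involutive.coe_toPerm, hfirst s hs (neg w) w]
      simp only [FinWorld.rate, neg]
      by_cases h : w.2.2 (w.1 (υ s)) (w.2.1 (a w s)) = false <;> simp [h]
    have e2 : ∑ w : FinWorld U K ι J, (if w.rate (υ s) (a w s) = false then (1 : ℝ) else 0) +
        ∑ w : FinWorld U K ι J, (if w.rate (υ s) (a w s) = false then (0 : ℝ) else 1) =
        Fintype.card (FinWorld U K ι J) := by
      rw [← sum_add_distrib, sum_congr rfl (g := fun _ => (1 : ℝ))]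
      · simp
      · intro w _
        split_ifs <;> simp
    linarith
  have hb : ∀ w : FinWorld U K ι J,
      ∑ s ∈ range N, (if w.rate (υ s) (a w s) = false then (1 : ℝ) else 0) ≤ badCount υ a H w := by
    intro w
    rw [badCount, sum_boole]
    exact_mod_cast card_le_card (filter_subset_filter _ (range_subset_range.2 hNH))
  refine le_trans (le_of_eq ?_) (sum_le_sum fun w _ => hb w)
  rw [sum_comm, sum_congr rfl fun s h => hs s (mem_range.1 h), sum_const, card_range, nsmul_eq_mul]
  ring

end FiniteModel

/-! ### Numerical estimates -/

section Numerics

open Finset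

lemma five_lt_logb {N : ℕ} (hN : 32 < N) : 5 < Real.logb 2 N := by
  rw [Real.lt_logb_iff_rpow_lt (by norm_num) (by positivity)]
  have : ((2 : ℝ) ^ (5 : ℝ)) = 32 := by norm_num
  rw [this]
  exact_mod_cast hN

/-- The logarithm lies below its tangent at `32`. -/
lemma five_mul_logb_le {N : ℕ} (hN : 32 < N) : 5 * Real.logb 2 N ≤ N := by
  have hN' : (32 : ℝ) < N := by exact_mod_cast hN
  have h2 := Real.log_two_gt_d9
  have h1 : Real.log N ≤ 5 * Real.log 2 + (N / 32 - 1) := by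
    have e : (N : ℝ) = 32 * (N / 32) := by ring
    have h32 : Real.log 32 = 5 * Real.log 2 := by
      rw [show (32 : ℝ) = 2 ^ 5 by norm_num, Real.log_pow]; norm_num
    rw [e, Real.log_mul (by norm_num) (by positivity), h32]
    have := Real.log_le_sub_one_of_pos (show 0 < (N : ℝ) / 32 by positivity)
    have e2 : (32 * ((N : ℝ) / 32)) = N := by ring
    rw [e2]
    linarith
  rw [Real.logb, ← mul_div_assoc, div_le_iff₀ (by linarith)]
  nlinarith

lemma log_eq_logb_mul {x : ℝ} : Real.log x = Real.logb 2 x * Real.log 2 := by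
  rw [Real.logb, div_mul_cancel₀]
  exact (Real.log_pos (by norm_num)).ne'

lemma exp_logb_mul {x : ℝ} (hx : 0 < x) : Real.exp (Real.logb 2 x * Real.log 2) = x := by
  rw [← log_eq_logb_mul, Real.exp_log hx]

/-- The union bound and the extra factor `N` combine to `(2 * N) ^ (r + 1)`, which the exponent
absorbs. -/
lemma failure_le {N : ℕ} (hN : 0 < N) {r : ℕ} {x : ℝ}
    (hx : Real.log 2 * (Real.logb 2 N + 1) * (r + 1) ≤ x) :
    2 * (2 * (N : ℝ)) ^ r * Real.exp (-x) ≤ 1 / N := by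
  have hN0 : (0 : ℝ) < N := by exact_mod_cast hN
  have h1 : 2 * (N : ℝ) = Real.exp (Real.log 2 * (Real.logb 2 N + 1)) := by
    rw [mul_add, Real.exp_add, mul_comm (Real.log 2), exp_logb_mul hN0, mul_one,
      Real.exp_log (by norm_num), mul_comm]
  rw [le_div_iff₀ hN0]
  calc 2 * (2 * (N : ℝ)) ^ r * Real.exp (-x) * N
      = (2 * (N : ℝ)) ^ (r + 1) * Real.exp (-x) := by ring
    _ = Real.exp (Real.log 2 * (Real.logb 2 N + 1) * (r + 1) - x) := by
        rw [h1, ← Real.exp_nat_mul, ← Real.exp_add]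
        congr 1
        push_cast
        ring
    _ ≤ 1 := by
        rw [Real.exp_le_one_iff]
        linarith

/-- Write `q = (y * a) ^ 5`. The threshold says `2 ^ r ≤ y ^ 4`, so `q / 2 ^ r ≥ y * a ^ 5`. The
right side is then at least `y * a ^ 3 / 4`, while the left is at most `4 * (a + 1) * y`. -/
lemma failure_exponent_le {a q : ℝ} (ha : 5 < a) (hq : 0 < q) {r : ℕ}
    (hr : (r : ℝ) ≤ 0.8 * Real.logb 2 q - 4 * Real.logb 2 a) :
    Real.log 2 * (a + 1) * (r + 1) ≤ (1 / a) ^ 2 / 4 * (q / 2 ^ r) := by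
  have ha0 : 0 < a := by linarith
  have hl0 : 0 < Real.log 2 := Real.log_pos (by norm_num)
  have hl1 := Real.log_two_lt_d9
  set ly := Real.logb 2 q / 5 - Real.logb 2 a with hly
  set y := Real.exp (ly * Real.log 2) with hy
  have hy0 : 0 < y := Real.exp_pos _
  have hqy : q = (y * a) ^ 5 := by
    have : y * a = Real.exp (Real.logb 2 q / 5 * Real.log 2) := by
      conv_lhs => rw [← exp_logb_mul ha0, hy, ← Real.exp_add]
      congr 1
      rw [hly]; ring
    rw [this, ← Real.exp_nat_mul]
    conv_lhs => rw [← exp_logb_mul hq]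
    congr 1
    push_cast
    ring
  have hr4 : (r : ℝ) ≤ 4 * ly := by rw [hly]; norm_num at hr ⊢; linarith
  have h2r : (2 : ℝ) ^ r ≤ y ^ 4 := by
    have : (2 : ℝ) ^ r = Real.exp (r * Real.log 2) := by
      rw [Real.exp_nat_mul, Real.exp_log (by norm_num)]
    rw [this, hy, ← Real.exp_nat_mul, Real.exp_le_exp]
    push_cast
    nlinarith
  have hqr : y * a ^ 5 ≤ q / 2 ^ r := by
    rw [le_div_iff₀ (by positivity)]
    calc y * a ^ 5 * 2 ^ r ≤ y * a ^ 5 * y ^ 4 := by gcongr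
      _ = q := by rw [hqy]; ring
  have hlogy : ly * Real.log 2 ≤ y - 1 := by
    have := Real.add_one_le_exp (ly * Real.log 2)
    rw [← hy] at this
    linarith
  have hrl : Real.log 2 * (r + 1) ≤ 4 * y := by nlinarith
  calc Real.log 2 * (a + 1) * (r + 1) = (a + 1) * (Real.log 2 * (r + 1)) := by ring
    _ ≤ (a + 1) * (4 * y) := by gcongr
    _ ≤ y * a ^ 3 / 4 := by
        have : 16 * (a + 1) ≤ a ^ 3 := by nlinarith [sq_nonneg (a - 5), mul_pos ha0 ha0]
        nlinarith
    _ = (1 / a) ^ 2 / 4 * (y * a ^ 5) := by field_simp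
    _ ≤ _ := by gcongr

/-- With `q = z ^ 5` one has `a ≤ z` and `2 ^ r ≤ 2 * z`, so a polynomial of degree two in `z` is
compared with `z ^ 4 / 32`. Here `η = 1 / 2`. -/
lemma failure_exponent_half_le {a q : ℝ} (ha : 5 < a) (hq : a ^ 5 ≤ q) {r : ℕ}
    (hr : (r : ℝ) ≤ Real.logb 2 q / 20 + 1) :
    Real.log 2 * (a + 1) * (r + 1) ≤ (1 / 2) ^ 2 / 4 * (q / 2 ^ r) := by
  have ha0 : 0 < a := by linarith
  have hq0 : 0 < q := lt_of_lt_of_le (by positivity) hq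
  have hl0 : 0 < Real.log 2 := Real.log_pos (by norm_num)
  have hl1 := Real.log_two_lt_d9
  set L := Real.logb 2 q with hL
  set z := Real.exp (L / 5 * Real.log 2) with hz
  have hz0 : 0 < z := Real.exp_pos _
  have hqz : q = z ^ 5 := by
    rw [hz, ← Real.exp_nat_mul]
    conv_lhs => rw [← exp_logb_mul hq0, ← hL]
    congr 1
    push_cast
    ring
  have haz : a ≤ z := by
    rw [hqz] at hq
    exact le_of_pow_le_pow_left₀ (by norm_num) hz0.le hq
  have hlogz : L / 5 * Real.log 2 ≤ z - 1 := by
    have := Real.add_one_le_exp (L / 5 * Real.log 2)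
    rw [← hz] at this
    linarith
  have hL0 : 0 ≤ L := by
    apply Real.logb_nonneg (by norm_num)
    have : (1 : ℝ) ≤ a ^ 5 := one_le_pow₀ (by linarith)
    linarith
  have h2r : (2 : ℝ) ^ r ≤ 2 * z := by
    have h1 : (2 : ℝ) ^ r = Real.exp (r * Real.log 2) := by
      rw [Real.exp_nat_mul, Real.exp_log (by norm_num)]
    have h2 : 2 * z = Real.exp (Real.log 2 + L / 5 * Real.log 2) := by
      rw [Real.exp_add, Real.exp_log (by norm_num)]
    rw [h1, h2, Real.exp_le_exp]
    nlinarith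
  have hqr : z ^ 4 / 2 ≤ q / 2 ^ r := by
    rw [div_le_div_iff₀ (by norm_num) (by positivity)]
    calc z ^ 4 * 2 ^ r ≤ z ^ 4 * (2 * z) := by gcongr
      _ = q * 2 := by rw [hqz]; ring
  have hrl : Real.log 2 * (r + 1) ≤ (z - 1) / 4 + 1.4 := by
    have : Real.log 2 * (r + 1) ≤ Real.log 2 * (L / 20 + 2) :=
      mul_le_mul_of_nonneg_left (by linarith) hl0.le
    linarith
  calc Real.log 2 * (a + 1) * (r + 1) = (a + 1) * (Real.log 2 * (r + 1)) := by ring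
    _ ≤ (z + 1) * ((z - 1) / 4 + 1.4) := by
        have : 0 ≤ Real.log 2 * ((r : ℝ) + 1) := by positivity
        gcongr
    _ ≤ z ^ 4 / 32 := by
        have hz5 : 5 < z := by linarith
        have h25 : 25 * z ^ 2 ≤ z ^ 4 := by
          have : 25 ≤ z ^ 2 := by nlinarith
          calc 25 * z ^ 2 ≤ z ^ 2 * z ^ 2 := by gcongr
            _ = z ^ 4 := by ring
        nlinarith
    _ = (1 / 2) ^ 2 / 4 * (z ^ 4 / 2) := by ring
    _ ≤ _ := by gcongr

lemma pow_five_le_of_threshold {a q : ℝ} (ha : 5 < a) (hq : 0 < q)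
    (hr : 1 ≤ 0.8 * Real.logb 2 q - 4 * Real.logb 2 a) : a ^ 5 ≤ q := by
  have h1 : Real.logb 2 (a ^ 5) ≤ Real.logb 2 q := by
    rw [Real.logb_pow]
    norm_num at hr ⊢
    linarith
  exact (Real.logb_le_logb (by norm_num) (by positivity) hq).1 h1

/-- The factor `q` is the union bound over item types; an exponent below `-3/2 * log q` beats it by
`√q`. -/
lemma mul_exp_le {q x : ℝ} (hq : 0 < q) (hx : x ≤ 1 - 3 / 2 * Real.log q) :
    q * Real.exp x ≤ 3 / √q := by
  have hs : 0 < √q := Real.sqrt_pos.2 hq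
  rw [le_div_iff₀ hs]
  have h1 : √q = Real.exp (Real.log q / 2) := by
    rw [Real.exp_half, Real.exp_log hq]
  calc q * Real.exp x * √q = Real.exp (Real.log q + x + Real.log q / 2) := by
        rw [Real.exp_add, Real.exp_add, Real.exp_log hq, h1]
    _ ≤ Real.exp 1 := by
        rw [Real.exp_le_exp]; linarith
    _ ≤ 3 := by
        have := Real.exp_one_lt_d9
        linarith

lemma three_div_sqrt_le {a q : ℝ} (ha : 5 < a) (hq : a ^ 5 ≤ q) : 3 / √q ≤ 3 / 10 * (1 / a) := by
  have ha0 : 0 < a := by linarith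
  have h1 : 10 * a ≤ √q := by
    apply Real.le_sqrt_of_sq_le
    refine le_trans ?_ hq
    have h3 : (125 : ℝ) ≤ a ^ 3 := by nlinarith [mul_pos ha0 ha0]
    calc (10 * a) ^ 2 = 100 * a ^ 2 := by ring
      _ ≤ a ^ 3 * a ^ 2 := by gcongr; linarith
      _ = a ^ 5 := by ring
  calc 3 / √q ≤ 3 / (10 * a) := by gcongr
    _ = _ := by field_simp

lemma eight_lt_log {a q : ℝ} (ha : 5 < a) (hq : a ^ 5 ≤ q) : 8 < Real.log q := by
  have h1 : (3125 : ℝ) < q := by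
    refine lt_of_lt_of_le ?_ hq
    calc (3125 : ℝ) = 5 ^ 5 := by norm_num
      _ < a ^ 5 := by gcongr
  rw [Real.lt_log_iff_exp_lt (by linarith)]
  have h2 : Real.exp 8 = Real.exp 1 ^ 8 := by rw [← Real.exp_nat_mul]; norm_num
  rw [h2]
  refine lt_trans ?_ h1
  have := Real.exp_one_lt_d9
  calc Real.exp 1 ^ 8 < (2.7182818286 : ℝ) ^ 8 := by gcongr
    _ < 3125 := by norm_num

end Numerics

/-! ### Lower bounds in the finite model with explicit parameters -/

section FiniteModel

open Finset

variable {U K ι J : Type*} [DecidableEq U] [DecidableEq K] [DecidableEq ι] [DecidableEq J]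
  [Fintype U] [Fintype K] [Fintype ι] [Fintype J]

lemma toNat_ratingThreshold_le {N q : ℕ} (hr : 1 ≤ ratingThreshold N q) :
    ((ratingThreshold N q).toNat : ℝ) ≤ 0.8 * Real.logb 2 q - 4 * Real.logb 2 (Real.logb 2 N) := by
  have h1 : ((ratingThreshold N q).toNat : ℤ) = ratingThreshold N q := Int.toNat_of_nonneg (by omega)
  have h2 : ((ratingThreshold N q).toNat : ℝ) = ((ratingThreshold N q : ℤ) : ℝ) := by
    exact_mod_cast h1
  rw [h2]
  exact Int.floor_le _

lemma one_le_of_threshold {N q : ℕ} (hr : 1 ≤ ratingThreshold N q) :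
    1 ≤ 0.8 * Real.logb 2 q - 4 * Real.logb 2 (Real.logb 2 N) := by
  have := Int.le_floor.1 hr
  exact_mod_cast this

lemma etaParam_bounds {N : ℕ} (hN : 32 < N) :
    0 < etaParam N ∧ etaParam N < 1 / 5 ∧ 1 / (N : ℝ) ≤ etaParam N / 5 := by
  have ha := five_lt_logb hN
  have ha5 := five_mul_logb_le hN
  have hN0 : (0 : ℝ) < N := by positivity
  unfold etaParam
  refine ⟨by positivity, ?_, ?_⟩
  · gcongr
  · rw [div_div, div_le_div_iff₀ hN0 (by linarith)]
    linarith

open Classical in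
lemma card_not_regular_threshold_le {N q : ℕ} (hN : 32 < N) (hK : Fintype.card K = N)
    (hJ : Fintype.card J = q) (hq : 0 < q) (hr : 1 ≤ ratingThreshold N q) :
    (#{X : K → J → Bool | ¬ RegularMatrix (ratingThreshold N q).toNat (etaParam N) X} : ℝ) ≤
      1 / N * Fintype.card (K → J → Bool) := by
  obtain ⟨h0, h1, -⟩ := etaParam_bounds hN
  refine (card_not_regular_le _ h0.le (by linarith)).trans ?_
  gcongr
  rw [hK, hJ]
  refine failure_le (by omega) ?_
  exact failure_exponent_le (five_lt_logb hN) (by exact_mod_cast hq) (toNat_ratingThreshold_le hr)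

/-- Here `θ = 2/3 * ℓ * log 2` and `β = 11/4 * L / ℓ`, so `θ * β = 11/6 * log q`, which exceeds the
required `3/2 * log q`. The growth term is `8/5 * ℓ * 2 ^ (-ℓ / 3)`, bounded through `x * exp (-x) ≤
exp (-1)`; the surplus `1/3 * log q > 8/3` absorbs it. -/
lemma zBound_exponent_le {L ℓ n q m : ℝ} (hL : L * Real.log 2 = Real.log q)
    (hlog : 8 < Real.log q) (hq : 0 < q) (hℓ : 0 < ℓ)
    (hm : m = 8 * q * L * Real.exp (-(ℓ * Real.log 2))) (hn : n = m * ℓ / (5 * L)) :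
    n / q * (Real.exp (2 / 3 * ℓ * Real.log 2) - 1) - 2 / 3 * ℓ * Real.log 2 * (11 / 4 * L / ℓ) ≤
      1 - 3 / 2 * Real.log q := by
  have hl1 := Real.log_two_gt_d9
  have hL0 : 0 < L := by
    by_contra h
    nlinarith
  set x := ℓ / 3 * Real.log 2 with hx
  have hx0 : 0 < x := by positivity
  have he : x * Real.exp (-x) ≤ 10 / 27 := by
    have h1 := Real.add_one_le_exp (x - 1)
    have h2 := Real.exp_one_gt_d9
    have h3 : x ≤ Real.exp x * Real.exp (-1) := by
      rw [← Real.exp_add]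
      have : x + -1 = x - 1 := by ring
      rw [this]; linarith
    have h4 : Real.exp (-1) ≤ 10 / 27 := by
      rw [Real.exp_neg, inv_le_comm₀ (Real.exp_pos _) (by norm_num)]
      norm_num
      linarith
    calc x * Real.exp (-x) ≤ Real.exp x * Real.exp (-1) * Real.exp (-x) := by gcongr
      _ = Real.exp (-1) := by rw [← Real.exp_add, ← Real.exp_add]; congr 1; ring
      _ ≤ _ := h4
  have h5 : n / q * Real.exp (2 / 3 * ℓ * Real.log 2) = 8 / 5 * (ℓ * Real.exp (-x)) := by
    have : Real.exp (-x) = Real.exp (-(ℓ * Real.log 2)) * Real.exp (2 / 3 * ℓ * Real.log 2) := by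
      rw [← Real.exp_add]; congr 1; rw [hx]; ring
    rw [this, hn, hm]
    field_simp
  have h6 : ℓ * Real.exp (-x) ≤ 1.604 := by
    have : ℓ * Real.exp (-x) * Real.log 2 ≤ 10 / 9 := by
      have : ℓ * Real.exp (-x) * Real.log 2 = 3 * (x * Real.exp (-x)) := by rw [hx]; ring
      linarith
    have h7 : 0 ≤ ℓ * Real.exp (-x) := by positivity
    nlinarith
  have h7 : 2 / 3 * ℓ * Real.log 2 * (11 / 4 * L / ℓ) = 11 / 6 * Real.log q := by
    rw [← hL]; field_simp; norm_num
  have h8 : 0 ≤ n / q := by rw [hn, hm]; positivity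
  rw [h7, mul_sub, h5]
  norm_num at h6
  linarith

/-- The lower bound `Z(T)` in the finite model. -/
theorem Fair.zBound_le {υ : ℕ → U} {a : FinWorld U K ι J → ℕ → ι} {H T N q : ℕ}
    (ha : Causal υ a H) (hf : Fair υ a H T) (hU : Fintype.card U = N)
    (hK : Fintype.card K = N) (hJ : Fintype.card J = q) (hN : 32 < N) (hq : 0 < q) (hT : 1 ≤ T)
    (hH : H = N * T) (hr : 1 ≤ ratingThreshold N q) :
    (1 - 3 * etaParam N) / 4 * (N * zBound N q T) * Fintype.card (FinWorld U K ι J) ≤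
      ∑ w, (badCount υ a H w : ℝ) := by
  have : Nonempty J := Fintype.card_pos_iff.1 (hJ ▸ hq)
  obtain ⟨hη0, hη5, hηN⟩ := etaParam_bounds hN
  have ha5 := five_lt_logb hN
  have hq0 : (0 : ℝ) < q := by exact_mod_cast hq
  have hN0 : (0 : ℝ) < N := by positivity
  have hT0 : (1 : ℝ) ≤ T := by exact_mod_cast hT
  have haq := pow_five_le_of_threshold ha5 hq0 (one_le_of_threshold hr)
  have hsq := three_div_sqrt_le ha5 haq
  change _ ≤ 3 / 10 * etaParam N at hsq
  have hlog := eight_lt_log ha5 haq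
  have hp := card_not_regular_threshold_le hN hK hJ hq hr
  set η := etaParam N
  set r := (ratingThreshold N q).toNat
  have hr1 : 1 ≤ r := by omega
  set C : ℝ := (Fintype.card (FinWorld U K ι J) : ℝ)
  have hC : 0 ≤ C := Nat.cast_nonneg _
  set L := Real.logb 2 q with hLdef
  have hL : L * Real.log 2 = Real.log q := log_eq_logb_mul.symm
  have hl1 := Real.log_two_gt_d9
  have hl2 := Real.log_two_lt_d9
  have hL0 : 0 < L := by
    by_contra h
    nlinarith
  have key : ∀ n₀ β θ : ℝ, 0 ≤ n₀ → 0 < β → β * n₀ ≤ 11 / 20 * (N * T) → 0 ≤ θ →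
      n₀ / q * (Real.exp θ - 1) - θ * β ≤ 1 - 3 / 2 * Real.log q →
      (1 - 3 * η) / 4 * n₀ * C ≤ ∑ w, (badCount υ a H w : ℝ) := by
    intro n₀ β θ hn hβ hnβ hθ hx
    have h1 := hf.le_sum_badCount_of_load ha hU hK (by omega) hr1 hη0.le (by linarith) hp hn hβ hnβ
      hθ (ε := 3 / √q) (by rw [hJ]; exact mul_exp_le hq0 hx)
    refine le_trans ?_ h1
    refine mul_le_mul_of_nonneg_right ?_ hC
    have h2 : (1 - 3 * η) / 4 ≤ (1 - η) / (4 * (1 + η)) * (1 - 11 / 5 / N - 1 / N - 3 / √q) := by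
      -- Missing types, irregular matrices and overload cost `11/25`, `1/5` and `3/10` of `η`
      -- respectively.
      have h3 : 1 - 47 / 50 * η ≤ 1 - 11 / 5 / N - 1 / N - 3 / √q := by
        have : 11 / 5 / (N : ℝ) = 11 / 5 * (1 / N) := by ring
        rw [this]
        linarith
      have h4 : 0 ≤ (1 - η) / (4 * (1 + η)) := div_nonneg (by linarith) (by linarith)
      refine le_trans ?_ (mul_le_mul_of_nonneg_left h3 h4)
      rw [div_mul_eq_mul_div, div_le_div_iff₀ (by norm_num) (by linarith)]
      nlinarith
    calc (1 - 3 * η) / 4 * n₀ ≤ (1 - η) / (4 * (1 + η)) * (1 - 11 / 5 / N - 1 / N - 3 / √q) * n₀ :=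
          mul_le_mul_of_nonneg_right h2 hn
      _ = _ := by ring
  -- `22/5 * log 2 - 2` is barely larger than `3/2 * log 2`; this serves both regimes with `θ = log
  -- 2`.
  have hlin : L * (2 - 22 / 5 * Real.log 2) ≤ 1 - 3 / 2 * Real.log q := by
    rw [← hL]
    nlinarith
  unfold zBound
  rw [← hLdef]
  split_ifs with c1 c2 c3
  · rw [lt_div_iff₀ (by positivity)] at c1
    have hs : 0 < √(q : ℝ) := Real.sqrt_pos.2 hq0
    have hsqq : √(q : ℝ) * √q = q := Real.mul_self_sqrt hq0.le
    have hs1 : 1 ≤ 4 * √(q : ℝ) := by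
      have : (1 : ℝ) ≤ q := by exact_mod_cast hq
      have := Real.one_le_sqrt.2 this
      linarith
    -- Three touched items of one type are unlikely here: with `exp θ = 4 * √q` the growth term is
    -- at most `8/3`, while `3 * θ` already contains `3/2 * log q`.
    have h1 := hf.le_sum_badCount_of_light ha hU hK (by omega) (b := 2) (by norm_num)
      (θ := Real.log (4 * √q)) (ε := 3 / √q) (Real.log_nonneg hs1) (by
        rw [hJ, Real.exp_log (by positivity)]
        refine mul_exp_le hq0 ?_
        have e1 : Real.log (4 * √q) = 2 * Real.log 2 + Real.log q / 2 := by
          rw [Real.log_mul (by norm_num) hs.ne', Real.log_sqrt hq0.le,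
            show (4 : ℝ) = 2 ^ 2 by norm_num, Real.log_pow]
          norm_num
        have e2 : (H : ℝ) / q * (4 * √q - 1) ≤ 8 / 3 := by
          rw [hH, div_mul_eq_mul_div, div_le_iff₀ hq0]
          push_cast
          have hNT : (N : ℝ) * T ≤ 2 / 3 * √q := by linarith
          calc (N : ℝ) * T * (4 * √q - 1) ≤ 2 / 3 * √q * (4 * √q) := by
                gcongr
                linarith
            _ = 8 / 3 * (√q * √q) := by ring
            _ = _ := by rw [hsqq]
        rw [e1]
        push_cast
        linarith)
    refine le_trans ?_ h1
    refine mul_le_mul_of_nonneg_right ?_ hC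
    have h3 : 1 - 3 * η ≤ 1 - 11 / 5 / N - 3 / √q := by
      have : 11 / 5 / (N : ℝ) = 11 / 5 * (1 / N) := by ring
      rw [this]
      linarith
    have h4 : (0 : ℝ) ≤ N * T := by positivity
    have h5 : 0 ≤ 1 - 3 * η := by linarith
    have h6 := mul_le_mul_of_nonneg_left h3 h4
    have h7 := mul_nonneg h4 h5
    push_cast
    have e : 11 / 40 * ((N : ℝ) * T / 2) * (1 - 11 / 5 / N - 3 / √q) =
      11 / 80 * (N * T * (1 - 11 / 5 / N - 3 / √q)) := by ring
    rw [e]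
    linarith
  · rw [lt_div_iff₀ hN0] at c2
    have hm0 : (0 : ℝ) < N * T := by positivity
    set ℓ := Real.logb 2 (8 * q * L) - Real.logb 2 (N * T) with hℓ
    have hℓ0 : 0 < ℓ := by
      rw [hℓ, sub_pos]
      apply Real.logb_lt_logb (by norm_num) hm0
      have := mul_pos hq0 hL0
      linarith
    have hm : (N : ℝ) * T = 8 * q * L * Real.exp (-(ℓ * Real.log 2)) := by
      rw [hℓ, sub_mul, neg_sub, Real.exp_sub, exp_logb_mul hm0, exp_logb_mul (by positivity)]
      field_simp
    have e : (N : ℝ) * (T / (5 * L) * ℓ) = N * T * ℓ / (5 * L) := by ring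
    rw [e]
    -- In this and the next two regimes `β` is chosen so that `β * n₀ = 11/20 * (N * T)` exactly.
    refine key _ (11 / 4 * L / ℓ) (2 / 3 * ℓ * Real.log 2) (by positivity) (by positivity) ?_
      (by positivity) ?_
    · apply le_of_eq; field_simp; norm_num
    · exact zBound_exponent_le hL hlog hq0 hℓ0 hm rfl
  · rw [lt_div_iff₀ hN0] at c3
    refine key _ (22 / 5 * L) (Real.log 2) (by positivity) (by positivity) ?_ (by positivity) ?_
    · apply le_of_eq; field_simp; norm_num
    · rw [Real.exp_log (by norm_num)]
      have h1 : N * ((T : ℝ) / (8 * L)) / q ≤ 2 * L := by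
        rw [div_le_iff₀ hq0, ← mul_div_assoc, div_le_iff₀ (by positivity)]
        nlinarith
      linarith
  · rw [not_lt, div_le_iff₀ hN0] at c3
    set s := √(T * q / N : ℝ) with hs
    have hs2 : s * s = T * q / N := Real.mul_self_sqrt (by positivity)
    have hsL : 4 * q * L / N ≤ s := by
      apply Real.le_sqrt_of_sq_le
      rw [div_pow, div_le_div_iff₀ (by positivity) hN0]
      have : (0 : ℝ) ≤ q * N := by positivity
      nlinarith
    have hs0 : 0 < s := lt_of_lt_of_le (by positivity) hsL
    refine key _ (11 / 10 * N * s / q) (Real.log 2) (by positivity) (by positivity) ?_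
      (by positivity) ?_
    · apply le_of_eq
      calc 11 / 10 * N * s / q * (N * (1 / 2 * s)) = 11 / 20 * (N * N) / q * (s * s) := by ring
        _ = _ := by rw [hs2]; field_simp
    · rw [Real.exp_log (by norm_num)]
      -- The mean load `n₀ / q` now exceeds `2 * L`, and `β` is `11/5` times this mean. As `1 - 11/5
      -- * log 2 < 0`, the case of mean `2 * L` is the worst.
      have h1 : 2 * L ≤ N * s / (2 * q) := by
        rw [div_le_iff₀ hN0] at hsL
        rw [le_div_iff₀ (by positivity)]
        linarith
      have e : N * (1 / 2 * s) / q * (2 - 1) - Real.log 2 * (11 / 10 * N * s / q) =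
          N * s / (2 * q) * (1 - 11 / 5 * Real.log 2) := by field_simp; ring
      rw [e]
      refine (mul_le_mul_of_nonpos_right h1 (by linarith)).trans ?_
      linarith

/-- The lower bound `rT/N` in the finite model. -/
theorem Fair.ratingThreshold_le {υ : ℕ → U} {a : FinWorld U K ι J → ℕ → ι} {H T N q : ℕ}
    (ha : Causal υ a H) (hf : Fair υ a H T) (hU : Fintype.card U = N)
    (hK : Fintype.card K = N) (hJ : Fintype.card J = q) (hN : 32 < N) (hq : 0 < q)
    (hr : 1 ≤ ratingThreshold N q) (hr2 : 2 * ratingThreshold N q ≤ N) :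
    (1 - 3 * etaParam N) / 2 * (ratingThreshold N q * T) * Fintype.card (FinWorld U K ι J) ≤
      ∑ w, (badCount υ a H w : ℝ) := by
  have : Nonempty J := Fintype.card_pos_iff.1 (hJ ▸ hq)
  obtain ⟨hη0, hη5, hηN⟩ := etaParam_bounds hN
  have hp := card_not_regular_threshold_le hN hK hJ hq hr
  set η := etaParam N
  have h1 := hf.le_sum_badCount_of_fresh ha hU hK (by omega) (r := (ratingThreshold N q).toNat)
    (by omega) hη0.le (by linarith) hp
  refine le_trans ?_ h1
  have h2 : (((ratingThreshold N q).toNat : ℕ) : ℝ) = ((ratingThreshold N q : ℤ) : ℝ) := by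
    have : ((ratingThreshold N q).toNat : ℤ) = ratingThreshold N q :=
      Int.toNat_of_nonneg (by omega)
    exact_mod_cast this
  rw [h2]
  have hrT : (0 : ℝ) ≤ ratingThreshold N q * T := by
    rw [← h2]; positivity
  -- Both `11 / 5 / N` and `1 / N` are measured by `1 / N ≤ η / 5`.
  have h3 : 1 - 16 / 25 * η ≤ 1 - 11 / 5 / N - 1 / N := by
    have : 11 / 5 / (N : ℝ) = 11 / 5 * (1 / N) := by ring
    rw [this]
    linarith
  have h4 : (1 - 3 * η) / 2 ≤ (1 - η) / (2 * (1 + η)) * (1 - 11 / 5 / N - 1 / N) := by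
    have h5 : 0 ≤ (1 - η) / (2 * (1 + η)) := div_nonneg (by linarith) (by linarith)
    refine le_trans ?_ (mul_le_mul_of_nonneg_left h3 h5)
    rw [div_mul_eq_mul_div, div_le_div_iff₀ (by norm_num) (by linarith)]
    nlinarith
  refine mul_le_mul_of_nonneg_right ?_ (Nat.cast_nonneg _)
  calc _ ≤ (1 - η) / (2 * (1 + η)) * (1 - 11 / 5 / N - 1 / N) * (ratingThreshold N q * T) :=
        mul_le_mul_of_nonneg_right h4 hrT
    _ = _ := by ring

/-- The logarithmic lower bound in the finite model. -/
theorem Fair.log_le {υ : ℕ → U} {a : FinWorld U K ι J → ℕ → ι} {H T N q : ℕ}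
    (ha : Causal υ a H) (hf : Fair υ a H T) (hU : Fintype.card U = N)
    (hK : Fintype.card K = N) (hJ : Fintype.card J = q) (hN : 32 < N) (hq : 0 < q)
    (haq : Real.logb 2 N ^ 5 ≤ q) (hr2 : 2 * ratingThreshold N q ≤ N) :
    3 / 400 * (Real.logb 2 q * T) * Fintype.card (FinWorld U K ι J) ≤
      ∑ w, (badCount υ a H w : ℝ) := by
  classical
  have : Nonempty J := Fintype.card_pos_iff.1 (hJ ▸ hq)
  have ha5 := five_lt_logb hN
  have haN := five_mul_logb_le hN
  have hN33 : (33 : ℝ) ≤ N := by exact_mod_cast hN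
  have hq0 : (0 : ℝ) < q := by exact_mod_cast hq
  set L := Real.logb 2 q with hL
  have hL0 : 0 ≤ L := by
    apply Real.logb_nonneg (by norm_num)
    exact_mod_cast hq
  -- A fixed `η = 1 / 2` permits an `r` proportional to `log q`, with no `log log N` correction.
  set r := ⌈L / 20⌉₊
  have hr1 : (r : ℝ) ≤ L / 20 + 1 := (Nat.ceil_lt_add_one (by positivity)).le
  have hr0 : L / 20 ≤ r := Nat.le_ceil _
  -- The hypothesis on the original threshold is used only to get `log q = O(N)`, hence `2 * r ≤ N`.
  have hLN : L ≤ 13 / 8 * N + 5 / 4 := by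
    have h1 : 0.8 * L - 4 * Real.logb 2 (Real.logb 2 N) < ratingThreshold N q + 1 :=
      Int.lt_floor_add_one _
    have h2 : (2 * ratingThreshold N q : ℝ) ≤ N := by exact_mod_cast hr2
    have h3 : Real.logb 2 (Real.logb 2 N) ≤ Real.logb 2 N := by
      rw [Real.logb_le_iff_le_rpow (by norm_num) (by linarith)]
      have h4 := Real.add_one_le_exp (Real.logb 2 N * Real.log 2)
      rw [Real.rpow_def_of_pos (by norm_num)]
      rw [exp_logb_mul (by linarith)] at h4
      rw [mul_comm (Real.log 2), exp_logb_mul (by linarith)]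
      linarith
    norm_num at h1
    linarith
  have hr3 : 2 * r ≤ N := by
    have : (2 * r : ℝ) ≤ N := by linarith
    exact_mod_cast this
  have hp : (#{X : K → J → Bool | ¬ RegularMatrix r (1 / 2) X} : ℝ) ≤
      1 / N * Fintype.card (K → J → Bool) := by
    refine (card_not_regular_le _ (by norm_num) (by norm_num)).trans ?_
    gcongr
    rw [hK, hJ]
    exact failure_le (by omega) (failure_exponent_half_le ha5 haq hr1)
  have h1 := hf.le_sum_badCount_of_fresh ha hU hK (by omega) hr3 (by norm_num) (by norm_num) hp
  refine le_trans ?_ h1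
  refine mul_le_mul_of_nonneg_right ?_ (Nat.cast_nonneg _)
  have h2 : (9 : ℝ) / 10 ≤ 1 - 11 / 5 / N - 1 / N := by
    have : 11 / 5 / (N : ℝ) + 1 / N ≤ 1 / 10 := by
      rw [← add_div, div_le_iff₀ (by linarith)]
      linarith
    linarith
  calc 3 / 400 * (L * T) = 1 / 6 * (L / 20 * T * (9 / 10)) := by ring
    _ ≤ 1 / 6 * (r * T * (1 - 11 / 5 / N - 1 / N)) := by gcongr
    _ = _ := by norm_num

end FiniteModel

/-! ### Reduction to the finite model -/

section Reduction

open Finset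

variable {N K q : ℕ} {S : Type u} [MeasurableSpace S]

/-! ### Finiteness and measurability of the run -/

namespace Algorithm

lemma history_congr (A : Algorithm N S) {w w' : World N K q} {ζ : S} {t : ℕ}
    (h : ∀ s < t, ∀ u, rating w' u (A.action w ζ u s) = rating w u (A.action w ζ u s)) :
    A.history w' ζ t = A.history w ζ t := by
  induction t with
  | zero => rfl
  | succ t ih =>
    have ih := ih fun s hs => h s (by omega)
    simp only [history, ih]
    congr 2
    funext u
    exact congrArg (Prod.mk _) (h t (by omega) u)

/-- Once the seed is fixed, only the ratings vary, with at most `2 ^ N` outcomes per round. -/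
lemma finite_range_history (A : Algorithm N S) (K q : ℕ) (ζ : S) (t : ℕ) :
    (Set.range fun w : World N K q => A.history w ζ t).Finite := by
  induction t with
  | zero => exact (Set.finite_singleton []).subset (by rintro _ ⟨w, rfl⟩; rfl)
  | succ t ih =>
    refine (Set.Finite.image2 (fun h (b : Fin N → Bool) => h ++ [fun u => (A.choose u h ζ, b u)]) ih
      Set.finite_univ).subset ?_
    rintro _ ⟨w, rfl⟩
    exact ⟨_, ⟨w, rfl⟩, fun u => rating w u (A.choose u (A.history w ζ t) ζ), trivial, rfl⟩

/-- For a fixed seed, only finitely many items can be recommended up to a given time. -/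
lemma exists_action_le (A : Algorithm N S) (K q : ℕ) (ζ : S) (T : ℕ) :
    ∃ M, ∀ (w : World N K q) (u : Fin N), ∀ t < T, A.action w ζ u t ≤ M := by
  have hfin : ∀ (u : Fin N) t, (Set.range fun w : World N K q => A.action w ζ u t).Finite := by
    intro u t
    refine ((A.finite_range_history K q ζ t).image fun h => A.choose u h ζ).subset ?_
    rintro _ ⟨w, rfl⟩
    exact ⟨_, ⟨w, rfl⟩, rfl⟩
  have hall : (⋃ u : Fin N, ⋃ t ∈ Set.Iio T,
      Set.range fun w : World N K q => A.action w ζ u t).Finite :=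
    Set.finite_iUnion fun u => (Set.finite_Iio T).biUnion fun t _ => hfin u t
  obtain ⟨M, hM⟩ := hall.bddAbove
  refine ⟨M, fun w u t ht => hM ?_⟩
  exact Set.mem_iUnion.2 ⟨u, Set.mem_iUnion₂.2 ⟨t, ht, w, rfl⟩⟩

lemma measurableSet_rating (u : Fin N) (i : ℕ) (b : Bool) :
    MeasurableSet {p : World N K q × S | rating p.1 u i = b} := by
  have : {p : World N K q × S | rating p.1 u i = b} =
      ⋃ k, ⋃ j, {p | p.1.1 u = k} ∩ {p | p.1.2.1 i = j} ∩ {p | p.1.2.2 k j = b} := by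
    ext p
    simp [rating]
  rw [this]
  refine MeasurableSet.iUnion fun k => MeasurableSet.iUnion fun j => ?_
  refine ((measurableSet_eq_fun ?_ measurable_const).inter
    (measurableSet_eq_fun ?_ measurable_const)).inter (measurableSet_eq_fun ?_ measurable_const) <;>
  fun_prop

lemma measurableSet_action_of_history (A : Algorithm N S) {t : ℕ}
    (h : ∀ l, MeasurableSet {p : World N K q × S | A.history p.1 p.2 t = l}) (u : Fin N) (i : ℕ) :
    MeasurableSet {p : World N K q × S | A.action p.1 p.2 u t = i} := by
  have : {p : World N K q × S | A.action p.1 p.2 u t = i} =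
      ⋃ l, {p | A.history p.1 p.2 t = l} ∩ {p | A.choose u l p.2 = i} := by
    ext p
    simp [action]
  rw [this]
  refine MeasurableSet.iUnion fun l => (h l).inter ?_
  exact ((A.measurable_choose u l).comp measurable_snd) (measurableSet_singleton i)

/-- Histories form a countable type, so it suffices to treat single values; the last round is
determined by the action and rating events at time `t`. -/
lemma measurableSet_history (A : Algorithm N S) (t : ℕ) (l : History N) :
    MeasurableSet {p : World N K q × S | A.history p.1 p.2 t = l} := by
  induction t generalizing l with
  | zero => exact MeasurableSet.const ([] = l)
  | succ t ih =>
    rcases List.eq_nil_or_concat l with rfl | ⟨l', x, rfl⟩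
    · convert MeasurableSet.empty
      simp [history]
    · have : {p : World N K q × S | A.history p.1 p.2 (t + 1) = l' ++ [x]} =
          {p | A.history p.1 p.2 t = l'} ∩
            ⋂ u, {p | A.action p.1 p.2 u t = (x u).1} ∩ {p | rating p.1 u (x u).1 = (x u).2} := by
        ext p
        simp only [history, Set.mem_ofPred_eq, Set.mem_inter_iff, Set.mem_iInter]
        constructor
        · intro h
          obtain ⟨h1, h2⟩ := List.append_inj' h rfl
          refine ⟨h1, fun u => ?_⟩
          have h3 := congrFun (List.singleton_inj.1 h2) u
          have h4 : A.action p.1 p.2 u t = (x u).1 := congrArg Prod.fst h3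
          refine ⟨h4, ?_⟩
          rw [← h4]
          exact congrArg Prod.snd h3
        · rintro ⟨h1, h2⟩
          rw [h1]
          congr 2
          funext u
          obtain ⟨h3, h4⟩ := h2 u
          unfold action at h3
          rw [h1] at h3
          rw [h3, h4]
      rw [List.concat_eq_append, this]
      exact (ih l').inter (MeasurableSet.iInter fun u =>
        (A.measurableSet_action_of_history ih u _).inter (measurableSet_rating u _ _))

lemma measurableSet_bad (A : Algorithm N S) (u : Fin N) (t : ℕ) :
    MeasurableSet {p : World N K q × S | rating p.1 u (A.action p.1 p.2 u t) = false} := by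
  have : {p : World N K q × S | rating p.1 u (A.action p.1 p.2 u t) = false} =
      ⋃ i, {p | A.action p.1 p.2 u t = i} ∩ {p | rating p.1 u i = false} := by
    ext p
    simp
  rw [this]
  exact MeasurableSet.iUnion fun i =>
    (A.measurableSet_action_of_history (A.measurableSet_history t) u i).inter
      (measurableSet_rating u i false)

/-- The proportion of disliked recommendations, summed over the first `T` time steps. -/
noncomputable def loss (A : Algorithm N S) (T : ℕ) (p : World N K q × S) : ℝ :=
  ∑ t ∈ Finset.range T, (1 / (N : ℝ)) *
    ∑ u : Fin N, if rating p.1 u (A.action p.1 p.2 u t) = false then (1 : ℝ) else 0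

lemma measurable_loss (A : Algorithm N S) (T : ℕ) :
    Measurable (A.loss T : World N K q × S → ℝ) := by
  unfold loss
  refine Finset.measurable_sum _ fun t _ => Measurable.const_mul ?_ _
  exact Finset.measurable_sum _ fun u _ =>
    Measurable.ite (A.measurableSet_bad u t) measurable_const measurable_const

lemma loss_nonneg (A : Algorithm N S) (T : ℕ) (p : World N K q × S) : 0 ≤ A.loss T p := by
  unfold loss
  refine sum_nonneg fun t _ => mul_nonneg (by positivity) (sum_nonneg fun u _ => ?_)
  split_ifs <;> norm_num

lemma loss_le (A : Algorithm N S) (T : ℕ) (p : World N K q × S) :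
    A.loss T p ≤ T * (1 / (N : ℝ) * N) := by
  unfold loss
  rw [← nsmul_eq_mul, ← card_range T, ← sum_const, card_range]
  refine sum_le_sum fun t _ => mul_le_mul_of_nonneg_left ?_ (by positivity)
  calc _ ≤ ∑ u : Fin N, (1 : ℝ) := sum_le_sum fun u _ => by split_ifs <;> norm_num
    _ = N := by simp

end Algorithm

/-! #### The law of the restriction to finitely many items -/

/-- The restriction of a world to the items `0, …, M`. -/
def restrictWorld (M : ℕ) (w : World N K q) :
    FinWorld (Fin N) (Fin K) (Fin (M + 1)) (Fin q) :=
  (w.1, fun i => w.2.1 i, w.2.2)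

/-- A world extending a given world with the items `0, …, M`. -/
def extendWorld {M : ℕ} (x : FinWorld (Fin N) (Fin K) (Fin (M + 1)) (Fin q)) : World N K q :=
  (x.1, fun i => x.2.1 (Fin.ofNat (M + 1) i), x.2.2)

lemma measurable_restrictWorld (M : ℕ) :
    Measurable (restrictWorld M : World N K q → _) := by
  unfold restrictWorld
  fun_prop

variable [NeZero K] [NeZero q]

instance : IsProbabilityMeasure (worldLaw N K q) := by
  unfold worldLaw; infer_instance

/-- Each fibre is a cylinder whose mass is a product not depending on the point, so the restricted
world is uniform. -/
lemma worldLaw_fiber_eq (M : ℕ) (x y : FinWorld (Fin N) (Fin K) (Fin (M + 1)) (Fin q)) :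
    worldLaw N K q (restrictWorld M ⁻¹' {x}) = worldLaw N K q (restrictWorld M ⁻¹' {y}) := by
  have h : ∀ x : FinWorld (Fin N) (Fin K) (Fin (M + 1)) (Fin q),
      (restrictWorld M ⁻¹' {x} : Set (World N K q)) = ({x.1} : Set (Fin N → Fin K)) ×ˢ
        ((Set.pi (Finset.range (M + 1)) fun i => {x.2.1 (Fin.ofNat (M + 1) i)}) ×ˢ
          ({x.2.2} : Set (Fin K → Fin q → Bool))) := by
    rintro ⟨x1, x2, x3⟩
    ext ⟨w1, w2, w3⟩
    simp only [restrictWorld, Set.mem_preimage, Set.mem_singleton_iff, Prod.mk.injEq, Set.mem_prod,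
      Set.mem_pi, Finset.mem_coe, Finset.mem_range]
    refine and_congr_right fun _ => and_congr_left fun _ => ?_
    constructor
    · rintro rfl i hi
      simp [Nat.mod_eq_of_lt hi]
    · intro h
      funext i
      simpa using h i i.2
  have hf : ∀ (n : ℕ) [NeZero n] (j : Fin n),
      (PMF.uniformOfFintype (Fin n)).toMeasure {j} = (n : ENNReal)⁻¹ := by
    intro n _ j
    rw [PMF.toMeasure_apply_singleton _ _ (measurableSet_singleton j)]
    simp
  have hB : ∀ b : Bool, (PMF.uniformOfFintype Bool).toMeasure {b} = (2 : ENNReal)⁻¹ := by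
    intro b
    rw [PMF.toMeasure_apply_singleton _ _ (measurableSet_singleton b)]
    simp
  have hv : ∀ x : FinWorld (Fin N) (Fin K) (Fin (M + 1)) (Fin q),
      worldLaw N K q (restrictWorld M ⁻¹' {x}) =
        (∏ _i : Fin N, (K : ENNReal)⁻¹) * ((∏ _i ∈ Finset.range (M + 1), (q : ENNReal)⁻¹) *
          ∏ _k : Fin K, ∏ _j : Fin q, (2 : ENNReal)⁻¹) := by
    intro x
    rw [h, worldLaw, Measure.prod_prod, Measure.prod_prod, Measure.pi_singleton,
      Measure.pi_singleton, Measure.infinitePi_pi _ (fun i _ => measurableSet_singleton _)]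
    simp only [Measure.pi_singleton, hf, hB]
  rw [hv, hv]

lemma worldLaw_fiber (M : ℕ) (x : FinWorld (Fin N) (Fin K) (Fin (M + 1)) (Fin q)) :
    (Fintype.card (FinWorld (Fin N) (Fin K) (Fin (M + 1)) (Fin q)) : ℝ) *
      (worldLaw N K q).real (restrictWorld M ⁻¹' {x}) = 1 := by
  have h1 : ∑ y : FinWorld (Fin N) (Fin K) (Fin (M + 1)) (Fin q),
      ((worldLaw N K q).map (restrictWorld M)).real {y} = 1 := by
    have : IsProbabilityMeasure ((worldLaw N K q).map (restrictWorld M)) :=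
      Measure.isProbabilityMeasure_map (measurable_restrictWorld M).aemeasurable
    rw [sum_measureReal_singleton]
    simp
  rw [← h1, ← nsmul_eq_mul, ← card_univ, ← sum_const]
  refine sum_congr rfl fun y _ => ?_
  rw [map_measureReal_apply (measurable_restrictWorld M) (measurableSet_singleton y),
    measureReal_def, measureReal_def, worldLaw_fiber_eq M x y]

lemma integral_comp_restrictWorld (M : ℕ)
    (g : FinWorld (Fin N) (Fin K) (Fin (M + 1)) (Fin q) → ℝ) :
    ∫ w, g (restrictWorld M w) ∂(worldLaw N K q) =
      (∑ x, g x) / Fintype.card (FinWorld (Fin N) (Fin K) (Fin (M + 1)) (Fin q)) := by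
  have : IsProbabilityMeasure ((worldLaw N K q).map (restrictWorld M)) :=
    Measure.isProbabilityMeasure_map (measurable_restrictWorld M).aemeasurable
  rw [← integral_map (φ := restrictWorld M) (measurable_restrictWorld M).aemeasurable
    (f := g) (measurable_of_finite g).aestronglyMeasurable,
    integral_fintype Integrable.of_finite, sum_div]
  refine sum_congr rfl fun x _ => ?_
  rw [map_measureReal_apply (measurable_restrictWorld M) (measurableSet_singleton x), smul_eq_mul]
  have h := worldLaw_fiber M x
  have hne : (Fintype.card (FinWorld (Fin N) (Fin K) (Fin (M + 1)) (Fin q)) : ℝ) ≠ 0 := by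
    intro h0
    rw [h0, zero_mul] at h
    exact zero_ne_one h
  rw [eq_div_iff hne, mul_right_comm, mul_comm _ (Fintype.card _ : ℝ), h, one_mul]

/-- Every finite world has positive mass. Thus almost sure absence of repetitions yields it for
every finite world, as `Fair` demands. -/
lemma exists_restrictWorld_of_ae {P : World N K q → Prop} (h : ∀ᵐ w ∂(worldLaw N K q), P w)
    (M : ℕ) (x : FinWorld (Fin N) (Fin K) (Fin (M + 1)) (Fin q)) :
    ∃ w, restrictWorld M w = x ∧ P w := by
  by_contra! hn
  have h0 : worldLaw N K q (restrictWorld M ⁻¹' {x}) = 0 :=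
    measure_mono_null (fun w hw => hn w hw) (ae_iff.1 h)
  have h1 := worldLaw_fiber M x
  rw [measureReal_def, h0] at h1
  simp at h1

/-! #### From algorithms to the finite model -/

/-- The user served at time `s` when the users are served in turn. -/
def userAt (N : ℕ) [NeZero N] (s : ℕ) : Fin N := Fin.ofNat N s

/-- The recommendations in the finite model, for a fixed seed. -/
def Algorithm.finAction [NeZero N] (A : Algorithm N S) (ζ : S) (M : ℕ)
    (x : FinWorld (Fin N) (Fin K) (Fin (M + 1)) (Fin q)) (s : ℕ) : Fin (M + 1) :=
  Fin.ofNat (M + 1) (A.action (extendWorld x) ζ (userAt N s) (s / N))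

variable [NeZero N]

lemma userAt_add (t : ℕ) (u : Fin N) : userAt N (u + N * t) = u := by
  ext
  simp [userAt, Nat.mod_eq_of_lt u.2]

lemma add_mul_div (t : ℕ) (u : Fin N) : (u + N * t) / N = t := by
  rw [Nat.add_mul_div_left _ _ (NeZero.pos N), Nat.div_eq_of_lt u.2, zero_add]

/-- Time `s` lies in round `s / N`, and all slots of earlier rounds precede it. `Causal` would even
allow seeing earlier users of the same round, so serving in turn loses nothing. -/
lemma Algorithm.causal_finAction (A : Algorithm N S) (ζ : S) (M H : ℕ) :
    Causal (userAt N) (A.finAction ζ M :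
      FinWorld (Fin N) (Fin K) (Fin (M + 1)) (Fin q) → ℕ → Fin (M + 1)) H := by
  intro x x' s _ h
  have : A.history (extendWorld x') ζ (s / N) = A.history (extendWorld x) ζ (s / N) := by
    refine A.history_congr fun t ht u => ?_
    have hlt : u + N * t < s := by
      have h1 : N * (t + 1) ≤ N * (s / N) := Nat.mul_le_mul_left _ ht
      have h2 := Nat.mul_div_le s N
      have := u.2
      rw [mul_add] at h1
      omega
    have h3 := h _ hlt
    simp only [finAction, userAt_add, add_mul_div] at h3
    exact h3
  unfold finAction action
  rw [this]

lemma Algorithm.finAction_first (A : Algorithm N S) (ζ : S) (M : ℕ) {s : ℕ} (hs : s < N)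
    (x x' : FinWorld (Fin N) (Fin K) (Fin (M + 1)) (Fin q)) :
    A.finAction ζ M x s = A.finAction ζ M x' s := by
  unfold finAction action
  rw [Nat.div_eq_of_lt hs]
  rfl

lemma Algorithm.history_extend_restrict (A : Algorithm N S) {ζ : S} {M T : ℕ}
    (hM : ∀ (w : World N K q) (u : Fin N), ∀ t < T, A.action w ζ u t ≤ M) (w : World N K q)
    {t : ℕ} (ht : t ≤ T) :
    A.history (extendWorld (restrictWorld M w)) ζ t = A.history w ζ t := by
  refine A.history_congr fun s hs u => ?_
  have h1 := hM w u s (by omega)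
  simp only [rating, extendWorld, restrictWorld, Fin.val_ofNat]
  rw [Nat.mod_eq_of_lt (by omega)]

lemma card_userAt (T : ℕ) (u : Fin N) : #{s ∈ range (T * N) | userAt N s = u} = T := by
  have : ({s ∈ range (T * N) | userAt N s = u} : Finset ℕ) =
      (range T).image fun t => u + N * t := by
    ext s
    simp only [mem_filter, mem_range, mem_image]
    constructor
    · rintro ⟨h1, rfl⟩
      refine ⟨s / N, ?_, ?_⟩
      · rwa [Nat.div_lt_iff_lt_mul (NeZero.pos N)]
      · simp [userAt, Nat.mod_add_div]
    · rintro ⟨t, ht, rfl⟩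
      refine ⟨?_, userAt_add t u⟩
      have h1 : (t + 1) * N ≤ T * N := Nat.mul_le_mul_right _ ht
      have := u.2
      rw [add_mul, mul_comm] at h1
      omega
  rw [this, card_image_of_injective, card_range]
  intro t t' h
  have := NeZero.pos N
  simp only [add_right_inj] at h
  exact Nat.eq_of_mul_eq_mul_left this h

lemma Algorithm.fair_finAction (A : Algorithm N S) {ζ : S} {M T : ℕ}
    (hM : ∀ (w : World N K q) (u : Fin N), ∀ t < T, A.action w ζ u t ≤ M)
    (hA : ∀ᵐ w ∂(worldLaw N K q), ∀ (u : Fin N) (s t : ℕ), s < t →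
      A.action w ζ u s ≠ A.action w ζ u t) :
    Fair (userAt N) (A.finAction ζ M :
      FinWorld (Fin N) (Fin K) (Fin (M + 1)) (Fin q) → ℕ → Fin (M + 1)) (T * N) T := by
  refine ⟨card_userAt T, fun x u s hs s' hs' he => ?_⟩
  obtain ⟨w, rfl, hw⟩ := exists_restrictWorld_of_ae hA M x
  have hlt : ∀ {s}, s < T * N → s / N < T := fun h => by
    rwa [Nat.div_lt_iff_lt_mul (NeZero.pos N)]
  have hact : ∀ {t}, t < T → A.action (extendWorld (restrictWorld M w)) ζ u t =
      A.action w ζ u t := by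
    intro t ht
    unfold action
    rw [A.history_extend_restrict hM w ht.le]
  obtain ⟨h1, h2⟩ := hs
  obtain ⟨h1', h2'⟩ := hs'
  simp only [finAction, h2, h2', hact (hlt h1), hact (hlt h1')] at he
  have he' := congrArg Fin.val he
  simp only [Fin.val_ofNat] at he'
  rw [Nat.mod_eq_of_lt (by have := hM w u _ (hlt h1); omega),
    Nat.mod_eq_of_lt (by have := hM w u _ (hlt h1'); omega)] at he'
  have hdiv : s / N = s' / N := by
    rcases lt_trichotomy (s / N) (s' / N) with h | h | h
    · exact absurd he' (hw u _ _ h)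
    · exact h
    · exact absurd he'.symm (hw u _ _ h)
  have hmod : s % N = s' % N := by
    have := congrArg Fin.val (h2.trans h2'.symm)
    simpa [userAt] using this
  rw [← Nat.div_add_mod s N, ← Nat.div_add_mod s' N, hdiv, hmod]

lemma sum_range_mul_eq (T : ℕ) (f : ℕ → ℝ) :
    ∑ s ∈ range (T * N), f s = ∑ t ∈ range T, ∑ u : Fin N, f (u + N * t) := by
  rw [← Fin.sum_univ_eq_sum_range, ← Fin.sum_univ_eq_sum_range (fun t => ∑ u : Fin N, f (u + N * t)),
    ← Fintype.sum_prod_type' (f := fun (t : Fin T) (u : Fin N) => f (u + N * t))]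
  exact (Fintype.sum_equiv finProdFinEquiv _ _ fun p => by simp [finProdFinEquiv]).symm

lemma Algorithm.loss_eq (A : Algorithm N S) {ζ : S} {M T : ℕ}
    (hM : ∀ (w : World N K q) (u : Fin N), ∀ t < T, A.action w ζ u t ≤ M) (w : World N K q) :
    A.loss T (w, ζ) =
      1 / N * badCount (userAt N) (A.finAction ζ M) (T * N) (restrictWorld M w) := by
  rw [badCount, ← sum_boole, sum_range_mul_eq, mul_sum]
  unfold loss
  refine sum_congr rfl fun t ht => ?_
  congr 1
  refine sum_congr rfl fun u _ => ?_
  have ht := mem_range.1 ht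
  have h1 : A.action (extendWorld (restrictWorld M w)) ζ u t = A.action w ζ u t := by
    unfold action
    rw [A.history_extend_restrict hM w ht.le]
  have h2 : (restrictWorld M w).rate (userAt N (u + N * t))
      (A.finAction ζ M (restrictWorld M w) (u + N * t)) = rating w u (A.action w ζ u t) := by
    unfold finAction
    rw [userAt_add, add_mul_div, h1]
    simp only [FinWorld.rate, rating, restrictWorld, Fin.val_ofNat]
    rw [Nat.mod_eq_of_lt (by have := hM w u t ht; omega)]
  simp only [h2]

/-- A lower bound in the finite model is a lower bound on the regret. -/
theorem Algorithm.le_regret (A : Algorithm N S) (ν : Measure S) [IsProbabilityMeasure ν]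
    (hA : A.NeverRepeats K q ν) {T : ℕ} {c : ℝ}
    (hc : ∀ (M : ℕ) (a : FinWorld (Fin N) (Fin K) (Fin (M + 1)) (Fin q) → ℕ → Fin (M + 1)),
      Causal (userAt N) a (T * N) → Fair (userAt N) a (T * N) T →
      (∀ s < N, ∀ x x', a x s = a x' s) →
      c * Fintype.card (FinWorld (Fin N) (Fin K) (Fin (M + 1)) (Fin q)) ≤
        ∑ x, (badCount (userAt N) a (T * N) x : ℝ)) :
    c / N ≤ A.regret K q ν T := by
  have hint : Integrable (A.loss T : World N K q × S → ℝ) ((worldLaw N K q).prod ν) := by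
    refine Integrable.of_bound (A.measurable_loss T).aestronglyMeasurable (T * (1 / (N : ℝ) * N))
      (ae_of_all _ fun p => ?_)
    rw [Real.norm_of_nonneg (A.loss_nonneg T p)]
    exact A.loss_le T p
  have hreg : A.regret K q ν T = ∫ ζ, ∫ w, A.loss T (w, ζ) ∂(worldLaw N K q) ∂ν :=
    integral_prod_symm _ hint
  have hswap : ∀ᵐ ζ ∂ν, ∀ᵐ w ∂(worldLaw N K q), ∀ (u : Fin N) (s t : ℕ), s < t →
      A.action w ζ u s ≠ A.action w ζ u t := by
    unfold NeverRepeats runLaw at hA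
    rw [← Measure.prod_swap] at hA
    exact Measure.ae_ae_of_ae_prod (ae_of_ae_map measurable_swap.aemeasurable hA)
  -- The bound `M` on the items depends on the seed, which is why the finite estimate is required
  -- for every `M` with the same `c`.
  have hle : ∀ᵐ ζ ∂ν, c / N ≤ ∫ w, A.loss T (w, ζ) ∂(worldLaw N K q) := by
    filter_upwards [hswap] with ζ hζ
    obtain ⟨M, hM⟩ := A.exists_action_le K q ζ T
    simp only [A.loss_eq hM]
    rw [integral_comp_restrictWorld M fun x =>
      1 / (N : ℝ) * badCount (userAt N) (A.finAction ζ M) (T * N) x, ← mul_sum]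
    have h1 := hc M (A.finAction ζ M) (A.causal_finAction ζ M _) (A.fair_finAction hM hζ)
      fun s hs x x' => A.finAction_first ζ M hs x x'
    have hcard : (0 : ℝ) < Fintype.card (FinWorld (Fin N) (Fin K) (Fin (M + 1)) (Fin q)) := by
      exact_mod_cast Fintype.card_pos
    rw [le_div_iff₀ hcard, div_mul_eq_mul_div, one_div, inv_mul_eq_div]
    gcongr
  rw [hreg]
  calc c / N = ∫ _ζ, c / N ∂ν := by simp
    _ ≤ _ := integral_mono_ae (integrable_const _) hint.integral_prod_right hle

end Reduction

/-! ### Regret bounds, and `zBound` in the simplified regimes -/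

section Regret

open Finset

lemma one_le_ratingThreshold {N q : ℕ} (hN : 32 < N) (hq : 25 * (Real.logb 2 N) ^ 5 < (q : ℝ)) :
    1 ≤ ratingThreshold N q := by
  have ha5 := five_lt_logb hN
  have ha0 : 0 < Real.logb 2 N := by linarith
  have h1 : Real.logb 2 25 + 5 * Real.logb 2 (Real.logb 2 N) ≤ Real.logb 2 q := by
    have := Real.logb_le_logb_of_le (b := 2) (by norm_num) (by positivity) hq.le
    rw [Real.logb_mul (by norm_num) (by positivity), Real.logb_pow] at this
    exact_mod_cast this
  have h2 : 4 ≤ Real.logb 2 25 := by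
    rw [Real.le_logb_iff_rpow_le (by norm_num) (by norm_num)]
    norm_num
  unfold ratingThreshold
  rw [Int.le_floor]
  norm_num
  linarith

lemma one_lt_logb_of_lt {N q : ℕ} [NeZero q] (hN : 32 < N) (hq : 25 * (Real.logb 2 N) ^ 5 < (q : ℝ)) :
    1 < Real.logb 2 q := by
  have ha5 := five_lt_logb hN
  rw [Real.lt_logb_iff_rpow_lt (by norm_num) (by exact_mod_cast NeZero.pos q)]
  have h1 : (1 : ℝ) ≤ Real.logb 2 N ^ 5 := one_le_pow₀ (by linarith)
  rw [Real.rpow_one]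
  linarith

variable {N q T : ℕ} [NeZero N] [NeZero q] {S : Type u} [MeasurableSpace S]

lemma half_le_regret (hT : 1 ≤ T) (ν : Measure S) [IsProbabilityMeasure ν] (A : Algorithm N S)
    (hA : A.NeverRepeats N q ν) : 1 / 2 ≤ A.regret N q ν T := by
  have h := A.le_regret ν hA (T := T) (c := N / 2) fun M a _ _ hfirst =>
    le_sum_badCount_of_const (Nat.le_mul_of_pos_left N hT) hfirst
  have hN : (N : ℝ) ≠ 0 := NeZero.ne _
  have e : (N : ℝ) / 2 / N = 1 / 2 := by field_simp
  rwa [e] at h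

lemma zBound_le_regret (hN : 32 < N) (hT : 1 ≤ T) (hr : 1 ≤ ratingThreshold N q)
    (ν : Measure S) [IsProbabilityMeasure ν] (A : Algorithm N S) (hA : A.NeverRepeats N q ν) :
    (1 - 3 * etaParam N) / 4 * zBound N q T ≤ A.regret N q ν T := by
  have h := A.le_regret ν hA (T := T) (c := (1 - 3 * etaParam N) / 4 * (N * zBound N q T))
    fun M a ha hf _ => hf.zBound_le ha (by simp) (by simp) (by simp) hN (NeZero.pos q) hT
      (mul_comm _ _) hr
  have hN : (N : ℝ) ≠ 0 := NeZero.ne _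
  have e : (1 - 3 * etaParam N) / 4 * (N * zBound N q T) / N =
    (1 - 3 * etaParam N) / 4 * zBound N q T := by field_simp
  rwa [e] at h

lemma ratingThreshold_le_regret (hN : 32 < N) (hr : 1 ≤ ratingThreshold N q)
    (hr2 : 2 * ratingThreshold N q ≤ N)
    (ν : Measure S) [IsProbabilityMeasure ν] (A : Algorithm N S) (hA : A.NeverRepeats N q ν) :
    (1 - 3 * etaParam N) / 2 * ((ratingThreshold N q : ℝ) / N * T) ≤ A.regret N q ν T := by
  have h := A.le_regret ν hA (T := T) (c := (1 - 3 * etaParam N) / 2 * (ratingThreshold N q * T))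
    fun M a ha hf _ => hf.ratingThreshold_le ha (by simp) (by simp) (by simp) hN (NeZero.pos q)
      hr hr2
  refine le_trans (le_of_eq ?_) h
  ring

lemma log_le_regret (hN : 32 < N) (haq : Real.logb 2 N ^ 5 ≤ q)
    (hr2 : 2 * ratingThreshold N q ≤ N)
    (ν : Measure S) [IsProbabilityMeasure ν] (A : Algorithm N S) (hA : A.NeverRepeats N q ν) :
    3 / 400 * (Real.logb 2 q / N * T) ≤ A.regret N q ν T := by
  have h := A.le_regret ν hA (T := T) (c := 3 / 400 * (Real.logb 2 q * T))
    fun M a ha hf _ => hf.log_le ha (by simp) (by simp) (by simp) hN (NeZero.pos q) haq hr2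
  refine le_trans (le_of_eq ?_) h
  ring

/-- In the logarithmic regime the bracket is at least `log 2 = 1` (base 2), since `N * T` is below
`4 * q * L`. -/
lemma div_log_le_zBound (hq : 1 < Real.logb 2 q)
    (h : (T : ℝ) < 16 * (q * (Real.logb 2 q) ^ 2 / N)) (hT : 1 ≤ T) :
    T / (8 * Real.logb 2 q) ≤ zBound N q T := by
  have hN0 : (0 : ℝ) < N := by exact_mod_cast NeZero.pos N
  have hq0 : (0 : ℝ) < q := by exact_mod_cast NeZero.pos q
  have hT0 : (0 : ℝ) < T := by exact_mod_cast hT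
  set L := Real.logb 2 q
  have h' : (T : ℝ) < 16 * q * L ^ 2 / N := by
    refine lt_of_lt_of_eq h ?_
    ring
  unfold zBound
  split_ifs with c1 c2
  · gcongr
    linarith
  · rw [lt_div_iff₀ hN0] at c2
    have h1 : 1 ≤ Real.logb 2 (8 * q * L) - Real.logb 2 (N * T) := by
      have h2 : Real.logb 2 (N * T) ≤ Real.logb 2 (4 * q * L) := by
        apply Real.logb_le_logb_of_le (by norm_num) (by positivity)
        linarith
      have h3 : Real.logb 2 (8 * q * L) = 1 + Real.logb 2 (4 * q * L) := by
        rw [show 8 * q * L = 2 * (4 * q * L) by ring,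
          Real.logb_mul (by norm_num) (by positivity), Real.logb_self_eq_one (by norm_num)]
      linarith
    calc T / (8 * L) ≤ T / (5 * L) := by gcongr; norm_num
      _ = T / (5 * L) * 1 := (mul_one _).symm
      _ ≤ _ := by gcongr
  · exact le_rfl

/-- As `N * T ≤ √q * L`, the bracket is at least `log √q = L / 2`, which cancels the denominator `5
* L`. -/
lemma tenth_le_zBound (hq : 1 < Real.logb 2 q)
    (h : (T : ℝ) ≤ √(q : ℝ) * Real.logb 2 q / N) (hT : 1 ≤ T) :
    T / 10 ≤ zBound N q T := by
  have hN0 : (0 : ℝ) < N := by exact_mod_cast NeZero.pos N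
  have hq0 : (0 : ℝ) < q := by exact_mod_cast NeZero.pos q
  have hq1 : (1 : ℝ) ≤ q := by exact_mod_cast NeZero.pos q
  have hT0 : (0 : ℝ) < T := by exact_mod_cast hT
  have hs : 0 < √(q : ℝ) := Real.sqrt_pos.2 hq0
  set L := Real.logb 2 q with hL
  rw [le_div_iff₀ hN0] at h
  have hL2 : Real.logb 2 √(q : ℝ) = L / 2 := by
    rw [Real.sqrt_eq_rpow, Real.logb_rpow_eq_mul_logb_of_pos hq0, hL]
    ring
  have hsq : √(q : ℝ) ≤ q := by
    rw [Real.sqrt_le_left hq0.le]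
    nlinarith
  have c2 : (T : ℝ) < 4 * q * L / N := by
    rw [lt_div_iff₀ hN0]
    have : √(q : ℝ) * L ≤ q * L := by gcongr
    have : 0 < q * L := by positivity
    linarith
  unfold zBound
  split_ifs with c1
  · gcongr
    norm_num
  · have h1 : L / 2 ≤ Real.logb 2 (8 * q * L) - Real.logb 2 (N * T) := by
      have h2 : Real.logb 2 (N * T) ≤ Real.logb 2 (√(q : ℝ) * L) := by
        apply Real.logb_le_logb_of_le (by norm_num) (by positivity)
        linarith
      have h3 : Real.logb 2 (√(q : ℝ) * (√(q : ℝ) * L)) ≤ Real.logb 2 (8 * q * L) := by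
        apply Real.logb_le_logb_of_le (by norm_num) (by positivity)
        rw [← mul_assoc, Real.mul_self_sqrt hq0.le]
        have : 0 < q * L := by positivity
        linarith
      rw [Real.logb_mul hs.ne' (by positivity), hL2] at h3
      linarith
    calc (T : ℝ) / 10 = T / (5 * L) * (L / 2) := by field_simp; norm_num
      _ ≤ _ := by gcongr

lemma zBound_eq_sqrt (hq : 1 < Real.logb 2 q)
    (h : 16 * (q * (Real.logb 2 q) ^ 2 / N) ≤ T) :
    zBound N q T = 1 / 2 * √(T * q / N) := by
  have hN0 : (0 : ℝ) < N := by exact_mod_cast NeZero.pos N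
  have hq0 : (0 : ℝ) < q := by exact_mod_cast NeZero.pos q
  have hq1 : (1 : ℝ) ≤ q := by exact_mod_cast NeZero.pos q
  set L := Real.logb 2 q
  have h3 : 16 * q * L ^ 2 / N ≤ T := by
    refine le_trans (le_of_eq ?_) h
    ring
  have h2 : 4 * q * L / N ≤ T := by
    refine le_trans ?_ h3
    gcongr ?_ / _
    have : 0 < q * L := by positivity
    nlinarith
  have h1 : 2 * √(q : ℝ) / (3 * N) ≤ T := by
    refine le_trans ?_ h2
    rw [div_le_div_iff₀ (by positivity) hN0]
    have hsq : √(q : ℝ) ≤ q := by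
      rw [Real.sqrt_le_left hq0.le]
      nlinarith
    have h4 : 2 * √(q : ℝ) ≤ 4 * q * L * 3 := by nlinarith
    calc 2 * √(q : ℝ) * N ≤ 4 * q * L * 3 * N := by gcongr
      _ = _ := by ring
  unfold zBound
  rw [if_neg (not_lt.2 h1), if_neg (not_lt.2 h2), if_neg (not_lt.2 h3)]

end Regret

theorem theoremt :
    -- the detailed bound
    (∀ (N q T : ℕ) [NeZero N] [NeZero q], 32 < N → 1 ≤ T →
      1 ≤ ratingThreshold N q → 2 * ratingThreshold N q ≤ N →
      ∀ (S : Type u) [MeasurableSpace S] (ν : Measure S) [IsProbabilityMeasure ν]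
        (A : Algorithm N S), A.NeverRepeats N q ν →
        A.regret N q ν T ≥
          (1 - 3 * etaParam N) / 2 *
              max 1 (max (1 / 2 * zBound N q T) ((ratingThreshold N q : ℝ) / N * T))
            - (T : ℝ) / N) ∧
    -- the simplified bound
    (∃ C c₁ c₂ c₃ : ℝ, 0 < C ∧ 0 < c₁ ∧ 0 < c₂ ∧ 0 < c₃ ∧
      ∀ (N q T : ℕ) [NeZero N] [NeZero q], 32 < N → 1 ≤ T →
        25 * (Real.logb 2 N) ^ 5 < (q : ℝ) → 2 * ratingThreshold N q ≤ N →
        ∀ (S : Type u) [MeasurableSpace S] (ν : Measure S) [IsProbabilityMeasure ν]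
          (A : Algorithm N S), A.NeverRepeats N q ν →
          ((T : ℝ) ≤ c₁ * (√(q : ℝ) * Real.logb 2 q / N) →
            A.regret N q ν T > C * T) ∧
          (c₁ * (√(q : ℝ) * Real.logb 2 q / N) ≤ T →
            (T : ℝ) < c₂ * (q * (Real.logb 2 q) ^ 2 / N) →
            A.regret N q ν T > C * (T / Real.logb 2 q)) ∧
          (c₂ * (q * (Real.logb 2 q) ^ 2 / N) ≤ T →
            (T : ℝ) < c₃ * (N * q / (Real.logb 2 q) ^ 2) →
            A.regret N q ν T > C * √(T * q / N)) ∧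
          (c₃ * (N * q / (Real.logb 2 q) ^ 2) ≤ T →
            A.regret N q ν T > C * (Real.logb 2 q / N * T))) := by
  -- `η < 1 / 5` gives `(1 - 3 * η) / 4 ≥ 1 / 10`. The four regimes then have constants `1/100`,
  -- `1/80`, `1/20` and `3/400`, all above `1/200`, which makes the inequalities strict.
  refine ⟨?_, 1 / 200, 1, 16, 1, by norm_num, by norm_num, by norm_num, by norm_num, ?_⟩
  · intro N q T _ _ hN hT hr hr2 S _ ν _ A hA
    obtain ⟨hη0, hη5, -⟩ := etaParam_bounds hN
    have h1 := half_le_regret hT ν A hA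
    have h2 := zBound_le_regret hN hT hr ν A hA
    have h3 := ratingThreshold_le_regret (T := T) hN hr hr2 ν A hA
    have h4 : (0 : ℝ) ≤ T / N := by positivity
    -- The bound holds even without subtracting `T / N`.
    have h5 : (1 - 3 * etaParam N) / 2 *
        max 1 (max (1 / 2 * zBound N q T) ((ratingThreshold N q : ℝ) / N * T)) ≤
        A.regret N q ν T := by
      rw [mul_max_of_nonneg _ _ (by linarith), mul_max_of_nonneg _ _ (by linarith)]
      refine max_le (by linarith) (max_le ?_ h3)
      refine le_trans (le_of_eq ?_) h2
      ring
    linarith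
  · intro N q T _ _ hN hT hq hr2 S _ ν _ A hA
    obtain ⟨hη0, hη5, -⟩ := etaParam_bounds hN
    have ha5 := five_lt_logb hN
    have hr := one_le_ratingThreshold hN hq
    have hL := one_lt_logb_of_lt hN hq
    have hN0 : (0 : ℝ) < N := by positivity
    have hq0 : (0 : ℝ) < q := by exact_mod_cast NeZero.pos q
    have hT0 : (0 : ℝ) < T := by exact_mod_cast hT
    have h2 := zBound_le_regret hN hT hr ν A hA
    have haq : Real.logb 2 N ^ 5 ≤ q := by
      have : 0 ≤ Real.logb 2 N ^ 5 := by positivity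
      linarith
    have h4 := log_le_regret (T := T) hN haq hr2 ν A hA
    have hz : 0 ≤ zBound N q T → 1 / 10 * zBound N q T ≤ A.regret N q ν T := fun h0 =>
      le_trans (mul_le_mul_of_nonneg_right (by linarith) h0) h2
    refine ⟨fun h => ?_, fun _ h => ?_, fun h _ => ?_, fun _ => ?_⟩
    · rw [one_mul] at h
      have h5 := tenth_le_zBound hL h hT
      have h6 := hz (le_trans (by positivity) h5)
      linarith
    · have h5 := div_log_le_zBound hL h hT
      have h6 := hz (le_trans (by positivity) h5)
      have h7 : (T : ℝ) / (8 * Real.logb 2 q) = 1 / 8 * (T / Real.logb 2 q) := by ring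
      have h8 : 0 < T / Real.logb 2 q := by positivity
      rw [h7] at h5
      linarith
    · have h5 := zBound_eq_sqrt hL h
      have h6 := hz (by rw [h5]; positivity)
      have h8 : 0 < √((T : ℝ) * q / N) := Real.sqrt_pos.2 (by positivity)
      rw [h5] at h6
      linarith
    · have h8 : 0 < Real.logb 2 q / N * T := by positivity
      linarith
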